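/- Let $N\ge 2$ be an integer, $\beta>1$ and $N'=\frac{N}{N-1}$. For a bounded domain (non-empty, open and connected set) $\Omega\subset\mathbb{R}^N$ put $$R_\Omega=\sup_{x\in\Omega}|x|,\qquad X_1(r)=\Big(\log\frac{e}{r}\Big)^{-1}\ (0<r\le 1),\qquad w_{2\beta}(x)=X_1\Big(\frac{|x|}{R_\Omega}\Big)^{-\beta(N-1)}\ (x\in\Omega\setminus\{0\}).$$ For $U=\Omega$ or $U=\Omega\setminus\{0\}$ let $W^{1,N}_0(U,w_{2\beta})$ be the closure of $C^1_c(U)$ under the norm $$\|\nabla u\|_{N,w_{2\beta}}=\Big(\int_{U}|\nabla u|^N\,w_{2\beta}\,dx\Big)^{1/N},$$ that is, the space of those $u\in L^N(U)$ with weak gradient $\nabla u$ for which there are $\varphi_k\in C^1_c(U)$ with $\varphi_k\to u$ in $L^N(U)$ and $\|\nabla\varphi_k-\nabla u\|_{N,w_{2\beta}}\to 0$. Then the following hold. (i) There is a constant $\alpha=\alpha(N,\beta)>0$, depending only on $N$ and $\beta$, such that for every bounded domain $\Omega\subset\mathbb{R}^N$ $$\sup_{\{u\in W^{1,N}_0(\Omega\setminus\{0\},\,w_{2\beta})\,:\,\|\nabla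 u\|_{N,w_{2\beta}}\le 1\}}\ \frac{1}{|\Omega|}\int_\Omega \exp\Big(\alpha\,|u(x)|^{N'}X_1\Big(\frac{|x|}{R_\Omega}\Big)^{-\beta}\Big)\,dx<\infty .$$ (ii) If $\Omega\subset\mathbb{R}^N$ is a bounded domain with $0\in\Omega$, then for every $\alpha>0$ $$\sup_{\{u\in W^{1,N}_0(\Omega,\,w_{2\beta})\,:\,\|\nabla u\|_{N,w_{2\beta}}\le 1\}}\ \frac{1}{|\Omega|}\int_\Omega \exp\Big(\alpha\,|u(x)|^{N'}X_1\Big(\frac{|x|}{R_\Omega}\Big)^{-\beta}\Big)\,dx=\infty .$$ -/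

import Mathlib

open MeasureTheory Filter Topology
open scoped ENNReal ContDiff

noncomputable section

namespace LogWeight

/-- `X₁(r) = (log (e / r))⁻¹` for `0 < r ≤ 1`. -/
def X1 (r : ℝ) : ℝ := (Real.log (Real.exp 1 / r))⁻¹

/-- `R_Ω = sup_{x ∈ Ω} |x|`. -/
def outerRadius {N : ℕ} (Ω : Set (EuclideanSpace ℝ (Fin N))) : ℝ :=
  sSup ((fun x : EuclideanSpace ℝ (Fin N) => ‖x‖) '' Ω)

/-- The weight `w_{2β}(x) = X₁(|x| / R_Ω) ^ (-β (N - 1))`, used on `Ω`, where `|x| < R_Ω`. -/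
def weight {N : ℕ} (β : ℝ) (Ω : Set (EuclideanSpace ℝ (Fin N)))
    (x : EuclideanSpace ℝ (Fin N)) : ℝ :=
  X1 (‖x‖ / outerRadius Ω) ^ (-(β * ((N : ℝ) - 1)))

/-- The measure `w dx` on `U`. -/
def weightedMeasure {N : ℕ} (U : Set (EuclideanSpace ℝ (Fin N)))
    (w : EuclideanSpace ℝ (Fin N) → ℝ) : Measure (EuclideanSpace ℝ (Fin N)) :=
  (volume.restrict U).withDensity (fun x => ENNReal.ofReal (w x))

/-- `φ ∈ C^k_c(U)`. -/
def IsCc {N : ℕ} (k : WithTop ℕ∞) (U : Set (EuclideanSpace ℝ (Fin N)))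
    (φ : EuclideanSpace ℝ (Fin N) → ℝ) : Prop :=
  ContDiff ℝ k φ ∧ HasCompactSupport φ ∧ tsupport φ ⊆ U

/-- `g` is the weak (distributional) gradient of `u` on the open set `U`. -/
def IsWeakGradient {N : ℕ} (U : Set (EuclideanSpace ℝ (Fin N)))
    (u : EuclideanSpace ℝ (Fin N) → ℝ)
    (g : EuclideanSpace ℝ (Fin N) → EuclideanSpace ℝ (Fin N)) : Prop :=
  LocallyIntegrableOn u U ∧ LocallyIntegrableOn g U ∧
    ∀ ψ : EuclideanSpace ℝ (Fin N) → ℝ, IsCc ∞ U ψ →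
      ∫ x in U, u x • gradient ψ x = - ∫ x in U, ψ x • g x

/-- `u ∈ W^{1,N}_0(U, w)` with weak gradient `g`: the pair is a limit of `C¹_c(U)` functions for
the norm `‖∇φ‖_{N,w}`. For `w ≥ 1` and bounded `U` convergence in this norm forces convergence
in `L^N(U)` (Poincaré), and this is the convergence through which an element of the
completion is a function. -/
structure MemW0 {N : ℕ} (U : Set (EuclideanSpace ℝ (Fin N)))
    (w : EuclideanSpace ℝ (Fin N) → ℝ)
    (u : EuclideanSpace ℝ (Fin N) → ℝ)
    (g : EuclideanSpace ℝ (Fin N) → EuclideanSpace ℝ (Fin N)) : Prop where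
  memLp : MemLp u (N : ℝ≥0∞) (volume.restrict U)
  memLp_grad : MemLp g (N : ℝ≥0∞) (weightedMeasure U w)
  weakGradient : IsWeakGradient U u g
  approx : ∃ φ : ℕ → EuclideanSpace ℝ (Fin N) → ℝ, (∀ k, IsCc 1 U (φ k)) ∧
    Tendsto (fun k => eLpNorm (fun x => φ k x - u x) (N : ℝ≥0∞) (volume.restrict U))
      atTop (𝓝 0) ∧
    Tendsto (fun k => eLpNorm (fun x => gradient (φ k) x - g x) (N : ℝ≥0∞)
      (weightedMeasure U w)) atTop (𝓝 0)

/-- The set of `u ∈ W^{1,N}_0(U, w)` with `‖∇u‖_{N,w} ≤ 1`. -/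
def unitBallW0 {N : ℕ} (U : Set (EuclideanSpace ℝ (Fin N)))
    (w : EuclideanSpace ℝ (Fin N) → ℝ) : Set (EuclideanSpace ℝ (Fin N) → ℝ) :=
  {u | ∃ g, MemW0 U w u g ∧ eLpNorm g (N : ℝ≥0∞) (weightedMeasure U w) ≤ 1}

/-- `⨍_Ω exp (α |u|^{N'} X₁(|x| / R_Ω)^{-β}) dx`, in `[0, ∞]`, with `N' = N / (N - 1)`. -/
def expMean {N : ℕ} (β α : ℝ) (Ω : Set (EuclideanSpace ℝ (Fin N)))
    (u : EuclideanSpace ℝ (Fin N) → ℝ) : ℝ≥0∞ :=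
  laverage (volume.restrict Ω) (fun x => ENNReal.ofReal (Real.exp
    (α * |u x| ^ ((N : ℝ) / ((N : ℝ) - 1)) * X1 (‖x‖ / outerRadius Ω) ^ (-β))))

end LogWeight

end

namespace LogWeight

/-! ### A Trudinger inequality with some positive exponent, from the `L¹` Sobolev inequality -/

section Trudinger

open Module

variable {E : Type*} [NormedAddCommGroup E] [NormedSpace ℝ E] [MeasurableSpace E] [BorelSpace E]
  [FiniteDimensional ℝ E]

/-! Put `t = 1 + log R_Ω - log |x|`, so that `X₁(|x|/R_Ω) = 1/t`, and `σ = β (N - 1) / N`. The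
weighted energy is `∫ (|∇φ| t^σ)^N`, and the exponent in the exponential is `α |φ t^σ|^{N'}`. Part
(i) is therefore the unweighted Trudinger inequality for `w = φ t^σ`, once the energy of `w` is
controlled. The product rule leaves the extra term `|φ| t^(σ-1) / |x|`, which a logarithmic Hardy
inequality bounds by the weighted energy (`integral_hardy_log_le`). Its constant is finite because
`N σ - N + 1 = (β - 1)(N - 1) > 0`, and it has no boundary term at the origin because `φ` vanishes
near it. Fatou's lemma passes from `C¹_c` functions to the whole space.

The Trudinger inequality needs no sharp exponent. The `L¹` Sobolev inequality gives decay of `μ {v >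
a}` from one level to the next, governed by the energy in the strip between them. Over `n` equal
strips the energies sum to at most 1, so AM-GM bounds their product by `n^(-n)`. A suitable step
height yields decay `e^(-2n)` (`exists_measure_lt_mul_rpow_le`), and summing over `n` bounds the
exponential integral.

For part (ii), a function constant and nonzero near the origin has finite weighted energy. There the
integrand is `exp (a t^β)` with `β > 1`, which outgrows every power of `1/|x|` and is not
integrable. -/

theorem deriv_smoothTransition_eq_zero {x : ℝ} (hx : x ∉ Set.Ioo (0 : ℝ) 1) :
    deriv Real.smoothTransition x = 0 := by
  rcases le_or_gt x 0 with h | h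
  · refine IsLocalMin.deriv_eq_zero (Eventually.of_forall fun y => ?_)
    rw [Real.smoothTransition.zero_of_nonpos h]
    exact Real.smoothTransition.nonneg y
  · refine IsLocalMax.deriv_eq_zero (Eventually.of_forall fun y => ?_)
    rw [Real.smoothTransition.one_of_one_le (by_contra fun h' => hx ⟨h, not_le.1 h'⟩)]
    exact Real.smoothTransition.le_one y

theorem exists_norm_deriv_smoothTransition_le :
    ∃ K : ℝ, 0 < K ∧ ∀ x, ‖deriv Real.smoothTransition x‖ ≤ K := by
  have hc : Continuous (deriv Real.smoothTransition) :=
    (Real.smoothTransition.contDiff (n := 1)).continuous_deriv le_rfl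
  obtain ⟨K, hK⟩ := (isCompact_Icc (a := (0 : ℝ)) (b := 1)).exists_bound_of_continuousOn
    hc.continuousOn
  refine ⟨max K 1, by positivity, fun x => ?_⟩
  by_cases hx : x ∈ Set.Ioo (0 : ℝ) 1
  · exact (hK x ⟨hx.1.le, hx.2.le⟩).trans (le_max_left _ _)
  · rw [deriv_smoothTransition_eq_zero hx]
    simp

/-- One step of the level set iteration: the isoperimetric form of the `L¹` Sobolev inequality
applied to a smooth truncation of `v` between the levels `a` and `a + h`. -/
theorem exists_measure_superlevel_le (μ : Measure E) [μ.IsAddHaarMeasure]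
    {p : ℝ} (hp : Real.HolderConjugate (finrank ℝ E) p) :
    ∃ D : ℝ, 0 < D ∧ ∀ v : E → ℝ, ContDiff ℝ 1 v → HasCompactSupport v →
      ∀ a h : ℝ, 0 ≤ a → 0 < h →
        μ {x | a + h < v x} ≤ ENNReal.ofReal (D * (h ^ p)⁻¹) *
          (∫⁻ x in {x | a < v x ∧ v x < a + h}, ‖fderiv ℝ v x‖ₑ ^ (finrank ℝ E : ℝ) ∂μ) ^ (p - 1) *
          μ {x | a < v x} := by
  obtain ⟨K, hK0, hK⟩ := exists_norm_deriv_smoothTransition_le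
  set C := lintegralPowLePowLIntegralFDerivConst μ p
  have hp0 : 0 < p := hp.symm.pos
  -- The `+ 1` only makes the constant positive.
  refine ⟨((C : ℝ) + 1) * K ^ p, by positivity, fun v hv hvc a h ha hh => ?_⟩
  set S : Set E := {x | a < v x ∧ v x < a + h} with hS
  have hSm : MeasurableSet S :=
    ((isOpen_lt continuous_const hv.continuous).inter
      (isOpen_lt hv.continuous continuous_const)).measurableSet
  set w : E → ℝ := fun x => Real.smoothTransition ((v x - a) / h) with hw
  have hw1 : ContDiff ℝ 1 w :=
    (Real.smoothTransition.contDiff (n := 1)).comp ((hv.sub contDiff_const).div_const h)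
  have hwc : HasCompactSupport w := by
    refine hvc.mono fun x hx hvx => hx ?_
    simp only [hw]
    rw [hvx]
    exact Real.smoothTransition.zero_of_nonpos (div_nonpos_of_nonpos_of_nonneg (by linarith) hh.le)
  have hfd (x : E) : fderiv ℝ w x
      = (deriv Real.smoothTransition ((v x - a) / h) * h⁻¹) • fderiv ℝ v x := by
    have h1 : HasDerivAt Real.smoothTransition
        (deriv Real.smoothTransition ((v x - a) / h)) ((v x - a) / h) :=
      ((Real.smoothTransition.contDiff (n := 1)).differentiable one_ne_zero _).hasDerivAt
    have h2 : HasFDerivAt (fun x => (v x - a) / h) (h⁻¹ • fderiv ℝ v x) x := by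
      simpa [div_eq_inv_mul] using
        (((hv.differentiable one_ne_zero x).hasFDerivAt.sub_const a).const_mul h⁻¹)
    rw [mul_smul]
    exact (h1.comp_hasFDerivAt x h2).fderiv
  have hbound (x : E) : ‖fderiv ℝ w x‖ₑ ≤
      S.indicator (fun x => ENNReal.ofReal (K * h⁻¹) * ‖fderiv ℝ v x‖ₑ) x := by
    by_cases hx : x ∈ S
    · rw [Set.indicator_of_mem hx, hfd, enorm_smul]
      gcongr
      rw [← ofReal_norm, norm_mul, norm_inv, Real.norm_of_nonneg hh.le]
      gcongr
      exact hK _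
    · rw [hfd, deriv_smoothTransition_eq_zero]
      · rw [zero_mul, zero_smul, ← ofReal_norm, norm_zero, ENNReal.ofReal_zero]
        exact zero_le
      · rintro ⟨h1, h2⟩
        refine hx ⟨?_, ?_⟩
        · have := (div_pos_iff_of_pos_right hh).1 h1
          linarith
        · rw [div_lt_one hh] at h2
          linarith
  have hgns := lintegral_pow_le_pow_lintegral_fderiv μ hw1 hwc hp
  have hleft : μ {x | a + h < v x} ≤ ∫⁻ x, ‖w x‖ₑ ^ p ∂μ := by
    have hm : MeasurableSet {x | a + h < v x} :=
      (isOpen_lt continuous_const hv.continuous).measurableSet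
    rw [← lintegral_indicator_one hm]
    refine lintegral_mono fun x => ?_
    by_cases hx : x ∈ {x | a + h < v x}
    · have : w x = 1 := by
        refine Real.smoothTransition.one_of_one_le ?_
        rw [one_le_div hh]
        have : a + h < v x := hx
        linarith
      simp [Set.indicator_of_mem hx, this]
    · simp [Set.indicator_of_notMem hx]
  have hfm : Measurable fun x => ‖fderiv ℝ v x‖ₑ := by
    have := hv.continuous_fderiv one_ne_zero
    fun_prop
  -- Hölder against the constant 1 on the strip. The factor `μ {a < v} ^ (1 / p)` becomes linear
  -- after the Sobolev power `p`, which is what lets the estimate be iterated.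
  have hholder : ∫⁻ x in S, ‖fderiv ℝ v x‖ₑ ∂μ ≤
      (∫⁻ x in S, ‖fderiv ℝ v x‖ₑ ^ (finrank ℝ E : ℝ) ∂μ) ^ (1 / (finrank ℝ E : ℝ)) *
        μ {x | a < v x} ^ (1 / p) := by
    have := ENNReal.lintegral_mul_le_Lp_mul_Lq (μ.restrict S) hp hfm.aemeasurable
      (g := fun _ => 1) aemeasurable_const
    simp only [Pi.mul_apply, mul_one, ENNReal.one_rpow, lintegral_const, one_mul,
      Measure.restrict_apply MeasurableSet.univ, Set.univ_inter] at this
    refine this.trans ?_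
    gcongr
    exact fun x hx => hx.1
  have hright : ∫⁻ x, ‖fderiv ℝ w x‖ₑ ∂μ ≤ ENNReal.ofReal (K * h⁻¹) *
      ((∫⁻ x in S, ‖fderiv ℝ v x‖ₑ ^ (finrank ℝ E : ℝ) ∂μ) ^ (1 / (finrank ℝ E : ℝ)) *
        μ {x | a < v x} ^ (1 / p)) := by
    refine (lintegral_mono hbound).trans ?_
    rw [lintegral_indicator hSm, lintegral_const_mul _ hfm]
    gcongr
  refine hleft.trans (hgns.trans ?_)
  have hN0 : (0 : ℝ) < finrank ℝ E := hp.pos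
  have hpN : 1 / (finrank ℝ E : ℝ) * p = p - 1 := by
    have h3 := hp.mul_eq_add
    field_simp
    nlinarith
  calc (C : ℝ≥0∞) * (∫⁻ x, ‖fderiv ℝ w x‖ₑ ∂μ) ^ p
      ≤ ENNReal.ofReal ((C : ℝ) + 1) * (ENNReal.ofReal (K * h⁻¹) *
      ((∫⁻ x in S, ‖fderiv ℝ v x‖ₑ ^ (finrank ℝ E : ℝ) ∂μ) ^ (1 / (finrank ℝ E : ℝ)) *
        μ {x | a < v x} ^ (1 / p))) ^ p := by
        gcongr
        rw [ENNReal.ofReal_add (by positivity) (by positivity), ENNReal.ofReal_coe_nnreal]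
        exact le_self_add
    _ = _ := by
        rw [ENNReal.mul_rpow_of_nonneg _ _ hp0.le, ENNReal.mul_rpow_of_nonneg _ _ hp0.le,
          ← ENNReal.rpow_mul, ← ENNReal.rpow_mul, hpN, one_div_mul_cancel hp0.ne',
          ENNReal.rpow_one, ENNReal.ofReal_rpow_of_nonneg (by positivity) hp0.le,
          ← mul_assoc, ← mul_assoc, ← ENNReal.ofReal_mul (by positivity),
          Real.mul_rpow hK0.le (by positivity), Real.inv_rpow hh.le, mul_assoc (_ + _)]

/-- AM-GM, applied below to the energies in the level strips. -/
theorem prod_le_inv_pow_of_sum_le_one {n : ℕ} (hn : 0 < n) (e : ℕ → ℝ≥0∞)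
    (he : ∑ i ∈ Finset.range n, e i ≤ 1) :
    ∏ i ∈ Finset.range n, e i ≤ ENNReal.ofReal ((n : ℝ)⁻¹ ^ n) := by
  have hfin : ∀ i ∈ Finset.range n, e i ≠ ⊤ := fun i hi =>
    ((Finset.single_le_sum (fun _ _ => zero_le) hi).trans he).trans_lt ENNReal.one_lt_top |>.ne
  have hn' : (0 : ℝ) < n := by exact_mod_cast hn
  have hs : ∑ i ∈ Finset.range n, (e i).toReal ≤ 1 := by
    rw [← ENNReal.toReal_sum hfin]
    exact ENNReal.toReal_le_of_le_ofReal zero_le_one (by simpa using he)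
  have key := Real.geom_mean_le_arith_mean (Finset.range n) (fun _ => 1) (fun i => (e i).toReal)
    (fun _ _ => zero_le_one) (by simpa using hn) (fun _ _ => ENNReal.toReal_nonneg)
  simp only [Real.rpow_one, one_mul, Finset.sum_const, Finset.card_range, nsmul_eq_mul,
    mul_one] at key
  have hP : 0 ≤ ∏ i ∈ Finset.range n, (e i).toReal :=
    Finset.prod_nonneg fun _ _ => ENNReal.toReal_nonneg
  have key2 : ∏ i ∈ Finset.range n, (e i).toReal ≤ (n : ℝ)⁻¹ ^ n := by
    calc ∏ i ∈ Finset.range n, (e i).toReal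
        = ((∏ i ∈ Finset.range n, (e i).toReal) ^ (n : ℝ)⁻¹) ^ n := by
          rw [Real.rpow_inv_natCast_pow hP hn.ne']
      _ ≤ (n : ℝ)⁻¹ ^ n := by
          gcongr
          refine key.trans ?_
          rw [← one_div]
          gcongr
  rw [← ENNReal.toReal_prod] at key2
  exact (ENNReal.le_ofReal_iff_toReal_le (ENNReal.prod_ne_top hfin) (by positivity)).2 key2

/-- Exponential decay of the superlevel sets in the scale `v ^ p`. -/
theorem exists_measure_lt_mul_rpow_le (μ : Measure E) [μ.IsAddHaarMeasure]
    {p : ℝ} (hp : Real.HolderConjugate (finrank ℝ E) p) :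
    ∃ α : ℝ, 0 < α ∧ ∀ v : E → ℝ, ContDiff ℝ 1 v → HasCompactSupport v →
      ∫⁻ x, ‖fderiv ℝ v x‖ₑ ^ (finrank ℝ E : ℝ) ∂μ ≤ 1 → ∀ n : ℕ,
        μ {x | 0 < v x ∧ n < α * v x ^ p} ≤
          ENNReal.ofReal (Real.exp (-2) ^ n) * μ {x | 0 < v x} := by
  obtain ⟨D, hD, hstep⟩ := exists_measure_superlevel_le μ hp
  have hp0 : 0 < p := hp.symm.pos
  have hp1 : 0 ≤ p - 1 := hp.symm.sub_one_pos.le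
  refine ⟨(Real.exp 2 * D)⁻¹, by positivity, fun v hv hvc hE n => ?_⟩
  rcases Nat.eq_zero_or_pos n with rfl | hn
  · simp only [pow_zero, ENNReal.ofReal_one, one_mul]
    exact measure_mono fun x hx => hx.1
  have hn' : (0 : ℝ) < n := by exact_mod_cast hn
  -- Two requirements fix `h`. The factor `D / h^p` times the AM-GM gain `n^(-(p-1))` must be
  -- `e^(-2)` per step, and then the top level satisfies `(n h)^p = e² D n`, which dictates `α = (e²
  -- D)⁻¹`.
  set h : ℝ := (Real.exp 2 * D * (n : ℝ)⁻¹ ^ (p - 1)) ^ p⁻¹ with hh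
  have hh0 : 0 < h := by positivity
  have hhp : h ^ p = Real.exp 2 * D * (n : ℝ)⁻¹ ^ (p - 1) :=
    Real.rpow_inv_rpow (by positivity) hp0.ne'
  set S : ℕ → Set E := fun i => {x | i * h < v x ∧ v x < i * h + h} with hS
  have hSm (i : ℕ) : MeasurableSet (S i) :=
    ((isOpen_lt continuous_const hv.continuous).inter
      (isOpen_lt hv.continuous continuous_const)).measurableSet
  set e : ℕ → ℝ≥0∞ := fun i => ∫⁻ x in S i, ‖fderiv ℝ v x‖ₑ ^ (finrank ℝ E : ℝ) ∂μ with he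
  have hdisj : Pairwise (Function.onFun Disjoint S) := by
    have hlt : ∀ i j : ℕ, i < j → Disjoint (S i) (S j) := by
      intro i j hij
      refine Set.disjoint_left.2 fun x hx hy => ?_
      have h1 : ((i : ℝ) + 1) * h ≤ j * h := by
        gcongr
        exact_mod_cast hij
      have h2 := hx.2
      have h3 := hy.1
      linarith
    intro i j hij
    rcases lt_or_gt_of_ne hij with h' | h'
    · exact hlt i j h'
    · exact (hlt j i h').symm
  have hsum : ∑ i ∈ Finset.range n, e i ≤ 1 := by
    rw [he, ← lintegral_biUnion_finset (fun i _ j _ hij => hdisj hij) (fun i _ => hSm i)]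
    exact (setLIntegral_le_lintegral _ _).trans hE
  have hiter : ∀ m : ℕ, μ {x | m * h < v x} ≤ ENNReal.ofReal (D * (h ^ p)⁻¹) ^ m *
      (∏ i ∈ Finset.range m, e i) ^ (p - 1) * μ {x | 0 < v x} := by
    intro m
    induction m with
    | zero => simp
    | succ m ih =>
      have h1 := hstep v hv hvc (m * h) h (by positivity) hh0
      rw [Nat.cast_succ, add_mul, one_mul]
      refine h1.trans ?_
      refine (mul_le_mul_right ih _).trans (le_of_eq ?_)
      rw [Finset.prod_range_succ, ENNReal.mul_rpow_of_nonneg _ _ hp1, pow_succ]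
      ring
  have hsub : {x | 0 < v x ∧ n < (Real.exp 2 * D)⁻¹ * v x ^ p} ⊆ {x | n * h < v x} := by
    rintro x ⟨hx0, hx⟩
    rw [inv_mul_eq_div, lt_div_iff₀ (by positivity)] at hx
    refine (Real.rpow_lt_rpow_iff (by positivity) hx0.le hp0).1 (lt_of_le_of_lt (le_of_eq ?_) hx)
    rw [Real.mul_rpow hn'.le hh0.le, hhp, Real.inv_rpow hn'.le, Real.rpow_sub_one hn'.ne']
    have : (0 : ℝ) < (n : ℝ) ^ p := by positivity
    field_simp
  refine (measure_mono hsub).trans ((hiter n).trans ?_)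
  gcongr
  calc ENNReal.ofReal (D * (h ^ p)⁻¹) ^ n * (∏ i ∈ Finset.range n, e i) ^ (p - 1)
      ≤ ENNReal.ofReal (D * (h ^ p)⁻¹) ^ n * (ENNReal.ofReal ((n : ℝ)⁻¹ ^ n)) ^ (p - 1) := by
        gcongr
        exact prod_le_inv_pow_of_sum_le_one hn e hsum
    _ = ENNReal.ofReal (Real.exp (-2) ^ n) := by
        rw [ENNReal.ofReal_rpow_of_nonneg (by positivity) hp1, ← ENNReal.ofReal_pow (by positivity),
          ← ENNReal.ofReal_mul (by positivity), ← Real.rpow_natCast_mul (by positivity),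
          mul_comm (n : ℝ) (p - 1), Real.rpow_mul_natCast (by positivity), ← mul_pow, hhp,
          Real.exp_neg]
        have : (0 : ℝ) < (n : ℝ)⁻¹ ^ (p - 1) := by positivity
        congr 2
        field_simp

/-- A Trudinger inequality with a non-sharp exponent. -/
theorem exists_lintegral_exp_mul_abs_rpow_le (μ : Measure E) [μ.IsAddHaarMeasure]
    {p : ℝ} (hp : Real.HolderConjugate (finrank ℝ E) p) :
    ∃ α : ℝ, 0 < α ∧ ∃ C : ℝ≥0∞, C ≠ ⊤ ∧ ∀ v : E → ℝ, ContDiff ℝ 1 v → HasCompactSupport v →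
      ∫⁻ x, ‖fderiv ℝ v x‖ₑ ^ (finrank ℝ E : ℝ) ∂μ ≤ 1 → ∀ U : Set E, tsupport v ⊆ U →
        ∫⁻ x in U, ENNReal.ofReal (Real.exp (α * |v x| ^ p)) ∂μ ≤ C * μ U := by
  obtain ⟨α, hα, H⟩ := exists_measure_lt_mul_rpow_le μ hp
  have hp0 : 0 < p := hp.symm.pos
  -- On `n < α |v|^p ≤ n + 1` the integrand is at most `e^(n+1)`. The 2 accounts for `v` and `-v`;
  -- the decay rate `e^(-2)` beats the growth rate `e`.
  set c : ℕ → ℝ := fun n => Real.exp (n + 1) * (2 * Real.exp (-2) ^ n) with hc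
  have hcs : Summable c := by
    have : c = fun n : ℕ => 2 * Real.exp 1 * Real.exp (-1) ^ n := by
      ext n
      simp only [hc]
      rw [← Real.exp_nat_mul, ← Real.exp_nat_mul, mul_left_comm, ← Real.exp_add, mul_assoc,
        ← Real.exp_add]
      ring_nf
    rw [this]
    exact (summable_geometric_of_lt_one (by positivity) (by simp)).mul_left _
  refine ⟨α, hα, 1 + ∑' n, ENNReal.ofReal (c n),
    ENNReal.add_ne_top.2 ⟨ENNReal.one_ne_top, hcs.tsum_ofReal_ne_top⟩,
    fun v hv hvc hE U hU => ?_⟩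
  set A : ℕ → Set E := fun n => {x | (n : ℝ) < α * |v x| ^ p} with hA
  have hAm (n : ℕ) : MeasurableSet (A n) := by
    refine (isOpen_lt continuous_const ?_).measurableSet
    exact continuous_const.mul (hv.continuous.abs.rpow_const fun _ => Or.inr hp0.le)
  have hAle (n : ℕ) : μ (A n) ≤ ENNReal.ofReal (2 * Real.exp (-2) ^ n) * μ U := by
    have hsub : A n ⊆ {x | 0 < v x ∧ n < α * v x ^ p} ∪
        {x | 0 < (-v) x ∧ n < α * (-v) x ^ p} := by
      intro x hx
      have hx' : (n : ℝ) < α * |v x| ^ p := hx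
      rcases lt_trichotomy (v x) 0 with h | h | h
      · right
        rw [abs_of_neg h] at hx'
        exact ⟨by simpa using h, hx'⟩
      · rw [h, abs_zero, Real.zero_rpow hp0.ne', mul_zero] at hx'
        exact absurd hx' (not_lt.2 n.cast_nonneg)
      · left
        rw [abs_of_pos h] at hx'
        exact ⟨h, hx'⟩
    have h1 := H v hv hvc hE n
    have h2 := H (-v) hv.neg hvc.neg (by simpa [fderiv_neg] using hE) n
    have hs : {x | v x ≠ 0} ⊆ U := (subset_tsupport v).trans hU
    have h3 : μ {x | 0 < v x} ≤ μ U := measure_mono fun x hx => hs (ne_of_gt hx)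
    have h4 : μ {x | 0 < (-v) x} ≤ μ U := measure_mono fun x hx => hs (by
      have : 0 < - v x := hx
      exact (by linarith : v x < 0).ne)
    calc μ (A n) ≤ _ := measure_mono hsub
      _ ≤ _ := measure_union_le _ _
      _ ≤ ENNReal.ofReal (Real.exp (-2) ^ n) * μ U + ENNReal.ofReal (Real.exp (-2) ^ n) * μ U := by
          gcongr
          · exact h1.trans (by gcongr)
          · exact h2.trans (by gcongr)
      _ = _ := by
          rw [ENNReal.ofReal_mul zero_le_two, ENNReal.ofReal_ofNat]
          ring
  have hpt (x : E) : ENNReal.ofReal (Real.exp (α * |v x| ^ p)) ≤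
      1 + ∑' n : ℕ, (A n).indicator (fun _ => ENNReal.ofReal (Real.exp (n + 1))) x := by
    have hf0 : 0 ≤ α * |v x| ^ p := by positivity
    rcases hf0.eq_or_lt with h | h
    · rw [← h]
      simp
    -- The ceiling, rather than the floor, gives the strict lower bound required by `A n`.
    · obtain ⟨n, hn⟩ : ∃ n : ℕ, ⌈α * |v x| ^ p⌉₊ = n + 1 :=
        ⟨_, (Nat.succ_pred_eq_of_pos (Nat.ceil_pos.2 h)).symm⟩
      have h1 := Nat.le_ceil (α * |v x| ^ p)
      have h2 := Nat.ceil_lt_add_one h.le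
      rw [hn] at h1 h2
      push_cast at h1 h2
      have hxA : x ∈ A n := by
        change (n : ℝ) < _
        linarith
      calc ENNReal.ofReal (Real.exp (α * |v x| ^ p))
          ≤ (A n).indicator (fun _ => ENNReal.ofReal (Real.exp (n + 1))) x := by
            rw [Set.indicator_of_mem hxA]
            gcongr
        _ ≤ ∑' n : ℕ, (A n).indicator (fun _ => ENNReal.ofReal (Real.exp (n + 1))) x :=
            ENNReal.le_tsum (f := fun n : ℕ =>
              (A n).indicator (fun _ => ENNReal.ofReal (Real.exp (n + 1))) x) n
        _ ≤ _ := le_add_self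
  calc ∫⁻ x in U, ENNReal.ofReal (Real.exp (α * |v x| ^ p)) ∂μ
      ≤ ∫⁻ x in U, (1 + ∑' n : ℕ,
          (A n).indicator (fun _ => ENNReal.ofReal (Real.exp (n + 1))) x) ∂μ :=
        lintegral_mono hpt
    _ = μ U + ∑' n : ℕ, ∫⁻ x in U,
          (A n).indicator (fun _ => ENNReal.ofReal (Real.exp (n + 1))) x ∂μ := by
        rw [lintegral_add_left measurable_const, lintegral_tsum]
        · simp
        · exact fun n => (measurable_const.indicator (hAm n)).aemeasurable
    _ ≤ μ U + ∑' n : ℕ, ENNReal.ofReal (c n) * μ U := by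
        gcongr with n
        refine (setLIntegral_le_lintegral _ _).trans ?_
        rw [lintegral_indicator_const (hAm n), hc, ENNReal.ofReal_mul (by positivity), mul_assoc]
        gcongr
        exact hAle n
    _ = _ := by rw [ENNReal.tsum_mul_right, add_mul, one_mul]

end Trudinger

/-! ### A logarithmic Hardy inequality and the substitution `w = φ (c - log ‖x‖) ^ σ` -/

section Hardy

open Module

variable {E : Type*} [NormedAddCommGroup E]

/-- Off `tsupport f` the product vanishes locally, so singularities of `g` outside `U` do no harm.
Here `g` is a radial weight singular at the origin. -/
theorem contDiff_mul_of_tsupport_subset [NormedSpace ℝ E] {n : WithTop ℕ∞} {f g : E → ℝ}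
    {U : Set E} (hU : IsOpen U) (hf : ContDiff ℝ n f) (hfU : tsupport f ⊆ U)
    (hg : ContDiffOn ℝ n g U) : ContDiff ℝ n (fun x => f x * g x) := by
  rw [contDiff_iff_contDiffAt]
  intro x
  by_cases hx : x ∈ tsupport f
  · exact hf.contDiffAt.mul (hg.contDiffAt (hU.mem_nhds (hfU hx)))
  · refine (contDiffAt_const (c := (0 : ℝ))).congr_of_eventuallyEq ?_
    filter_upwards [notMem_tsupport_iff_eventuallyEq.1 hx] with y hy
    simp [hy]

theorem integrable_mul_of_tsupport_subset [NormedSpace ℝ E] [MeasurableSpace E] [BorelSpace E]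
    (μ : Measure E) [IsFiniteMeasureOnCompacts μ] {f g : E → ℝ} {U : Set E} (hU : IsOpen U)
    (hf : Continuous f) (hfc : HasCompactSupport f) (hfU : tsupport f ⊆ U)
    (hg : ContinuousOn g U) : Integrable (fun x => f x * g x) μ :=
  Continuous.integrable_of_hasCompactSupport
    (contDiff_zero.1 (contDiff_mul_of_tsupport_subset hU (contDiff_zero.2 hf) hfU
      (contDiffOn_zero.2 hg))) hfc.mul_right

/-- The divergence theorem for the field `f(x) x`: the identity field has divergence equal to the
dimension. -/
theorem integral_fderiv_apply_self [NormedSpace ℝ E] [FiniteDimensional ℝ E] [MeasurableSpace E]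
    [BorelSpace E] (μ : Measure E) [μ.IsAddHaarMeasure] {f : E → ℝ} (hf : ContDiff ℝ 1 f)
    (hfc : HasCompactSupport f) :
    ∫ x, fderiv ℝ f x x ∂μ = -(finrank ℝ E * ∫ x, f x ∂μ) := by
  set b := finBasis ℝ E
  set l : Fin (finrank ℝ E) → E →L[ℝ] ℝ := fun i => LinearMap.toContinuousLinearMap (b.coord i)
    with hl
  have hdc := hf.continuous_fderiv one_ne_zero
  have hint (i : Fin (finrank ℝ E)) : Integrable (fun x => l i x * fderiv ℝ f x (b i)) μ := by
    refine Continuous.integrable_of_hasCompactSupport (by fun_prop) ?_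
    exact (hfc.fderiv_apply ℝ (b i)).mul_left
  have hpart (i : Fin (finrank ℝ E)) :
      ∫ x, l i x * fderiv ℝ f x (b i) ∂μ = - ∫ x, f x ∂μ := by
    have h1 : l i (b i) = 1 := by simp [hl]
    rw [integral_mul_fderiv_eq_neg_fderiv_mul_of_integrable]
    · simp [h1]
    · simpa [h1] using hf.continuous.integrable_of_hasCompactSupport hfc
    · exact hint i
    · exact Continuous.integrable_of_hasCompactSupport
        ((l i).continuous.mul hf.continuous) hfc.mul_left
    · exact fun x _ => (l i).differentiableAt
    · exact fun x _ => hf.differentiable one_ne_zero x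
  have hsum (x : E) : fderiv ℝ f x x = ∑ i, l i x * fderiv ℝ f x (b i) := by
    conv_lhs => rw [← b.sum_repr x, map_sum]
    refine Finset.sum_congr rfl fun i _ => ?_
    rw [map_smul, smul_eq_mul, b.sum_repr x]
    rfl
  simp_rw [hsum]
  rw [integral_finsetSum _ fun i _ => hint i]
  simp [hpart]

/-- The punctured ball on which `c - log ‖x‖` is positive. -/
def logDomain (E : Type*) [NormedAddCommGroup E] (c : ℝ) : Set E :=
  {x | x ≠ 0 ∧ Real.log ‖x‖ < c}

theorem isOpen_logDomain (c : ℝ) : IsOpen (logDomain E c) := by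
  have h : ContinuousOn (fun y : E => Real.log ‖y‖) {x | x ≠ 0} :=
    continuous_norm.continuousOn.log fun x hx => norm_ne_zero_iff.2 hx
  exact h.isOpen_inter_preimage isOpen_ne isOpen_Iio

variable [InnerProductSpace ℝ E]

theorem hasFDerivAt_log_norm {x : E} (hx : x ≠ 0) :
    HasFDerivAt (fun y : E => Real.log ‖y‖) ((‖x‖ ^ 2)⁻¹ • innerSL ℝ x) x := by
  have h1 : HasFDerivAt (fun y : E => Real.log (‖y‖ ^ 2))
      ((‖x‖ ^ 2)⁻¹ • ((2 : ℕ) • innerSL ℝ x)) x :=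
    (hasStrictFDerivAt_norm_sq x).hasFDerivAt.log (by simpa using hx)
  have h2 := h1.const_mul (2⁻¹ : ℝ)
  refine (h2.congr_of_eventuallyEq (Eventually.of_forall fun y => ?_)).congr_fderiv ?_
  · simp [Real.log_pow]
  · ext y
    simp
    ring

theorem norm_fderiv_log_norm {x : E} (hx : x ≠ 0) :
    ‖(‖x‖ ^ 2)⁻¹ • innerSL ℝ x‖ = ‖x‖⁻¹ := by
  have : ‖x‖ ≠ 0 := norm_ne_zero_iff.2 hx
  rw [norm_smul, innerSL_apply_norm, norm_inv, norm_pow, norm_norm]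
  field_simp

theorem contDiffOn_comp_log_norm {n : WithTop ℕ∞} {c : ℝ} {F : ℝ → ℝ}
    (hF : ContDiffOn ℝ n F (Set.Iio c)) :
    ContDiffOn ℝ n (fun x : E => F (Real.log ‖x‖)) (logDomain E c) :=
  hF.comp (fun _ hx => ((contDiffAt_norm ℝ hx.1).log (norm_ne_zero_iff.2 hx.1)).contDiffWithinAt)
    fun _ hx => hx.2

theorem contDiffOn_sub_rpow {n : WithTop ℕ∞} (c r : ℝ) :
    ContDiffOn ℝ n (fun y : ℝ => (c - y) ^ r) (Set.Iio c) := fun _ hy =>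
  ((contDiffAt_const.sub contDiffAt_id).rpow_const_of_ne
    (sub_ne_zero.2 (ne_of_gt hy))).contDiffWithinAt

/-- Young's inequality, by comparing `P` with `(2 n / b) Q`. The coefficient `b / 2` is half the one
on the left of Hardy's inequality, so that the first term can be absorbed. -/
theorem mul_pow_mul_le {n : ℕ} (hn : 1 ≤ n) {b P Q : ℝ} (hb : 0 < b) (hP : 0 ≤ P) (hQ : 0 ≤ Q) :
    n * (P ^ (n - 1) * Q) ≤ b / 2 * P ^ n + n * (2 * n / b) ^ (n - 1) * Q ^ n := by
  have hn' : (0 : ℝ) < n := by exact_mod_cast hn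
  obtain ⟨m, rfl⟩ : ∃ m, n = m + 1 := ⟨n - 1, by omega⟩
  simp only [Nat.add_sub_cancel]
  set k : ℝ := ((m + 1 : ℕ) : ℝ)
  rcases le_total P (2 * k / b * Q) with h | h
  · calc k * (P ^ m * Q) ≤ k * ((2 * k / b * Q) ^ m * Q) := by gcongr
      _ = k * (2 * k / b) ^ m * Q ^ (m + 1) := by ring
      _ ≤ _ := le_add_of_nonneg_left (by positivity)
  · have h' : Q ≤ b / (2 * k) * P := by
      rw [div_mul_eq_mul_div, le_div_iff₀ (by positivity)]
      rw [div_mul_eq_mul_div, div_le_iff₀ hb] at h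
      linarith
    calc k * (P ^ m * Q) ≤ k * (P ^ m * (b / (2 * k) * P)) := by gcongr
      _ = b / 2 * P ^ (m + 1) := by
        field_simp
        ring
      _ ≤ _ := le_add_of_nonneg_right (by positivity)

variable [FiniteDimensional ℝ E] [MeasurableSpace E] [BorelSpace E]

/-- Hardy's inequality with a logarithmic weight, for functions supported away from the origin. -/
theorem integral_hardy_log_le (μ : Measure E) [μ.IsAddHaarMeasure] (hE : 2 ≤ finrank ℝ E)
    {σ b : ℝ} (hb : b = finrank ℝ E * σ - finrank ℝ E + 1) (hb0 : 0 < b) {c : ℝ} {φ : E → ℝ}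
    (hφ : ContDiff ℝ 1 φ) (hφc : HasCompactSupport φ) (hφU : tsupport φ ⊆ logDomain E c) :
    ∫ x, (|φ x| * (c - Real.log ‖x‖) ^ (σ - 1) * ‖x‖⁻¹) ^ finrank ℝ E ∂μ ≤
      2 / b * (finrank ℝ E * (2 * finrank ℝ E / b) ^ (finrank ℝ E - 1)) *
        ∫ x, (‖fderiv ℝ φ x‖ * (c - Real.log ‖x‖) ^ σ) ^ finrank ℝ E ∂μ := by
  set n := finrank ℝ E with hn
  have hn1 : (1 : ℝ) < n := by exact_mod_cast hE
  set U := logDomain E c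
  have hU : IsOpen U := isOpen_logDomain c
  set ψ : E → ℝ := fun x => ‖φ x‖ ^ (n : ℝ) with hψ
  have hψ1 : ContDiff ℝ 1 ψ := hφ.norm_rpow hn1
  have hψs : Function.support ψ ⊆ Function.support φ := fun x hx hx' => hx (by
    simp only [hψ]
    rw [hx', norm_zero, Real.zero_rpow (by positivity)])
  have hψt : tsupport ψ ⊆ tsupport φ := closure_mono hψs
  have hψc : HasCompactSupport ψ := hφc.mono hψs
  -- With `t = c - log ‖x‖`, `F (log ‖x‖) = t^b ‖x‖^(-n)`. The field `F (log ‖x‖) x` has divergence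
  -- `-b t^(b-1) ‖x‖^(-n)`, that is, `-b H (log ‖x‖)`: minus `b` times the Hardy weight, since `b -
  -- 1 = n (σ - 1)`.
  set F : ℝ → ℝ := fun y => (c - y) ^ b * Real.exp (-n * y) with hF
  set H : ℝ → ℝ := fun y => (c - y) ^ (b - 1) * Real.exp (-n * y) with hH
  have hexp : ContDiff ℝ 1 (fun y : ℝ => Real.exp (-n * y)) := by fun_prop
  have hF1 : ContDiffOn ℝ 1 F (Set.Iio c) := (contDiffOn_sub_rpow c b).mul hexp.contDiffOn
  have hH1 : ContDiffOn ℝ 1 H (Set.Iio c) := (contDiffOn_sub_rpow c _).mul hexp.contDiffOn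
  have hFd {y : ℝ} (hy : y < c) : HasDerivAt F (-b * H y - n * F y) y := by
    have h1 : HasDerivAt (fun y => (c - y) ^ b) (-1 * b * (c - y) ^ (b - 1)) y :=
      ((hasDerivAt_id y).const_sub c).rpow_const (Or.inl (sub_ne_zero.2 hy.ne'))
    have h2 : HasDerivAt (fun y : ℝ => Real.exp (-n * y)) (Real.exp (-n * y) * (-n * 1)) y :=
      ((hasDerivAt_id y).const_mul (-n : ℝ)).exp
    refine (h1.mul h2).congr_deriv ?_
    simp only [hF, hH]
    ring
  set G : E → ℝ := fun x => ψ x * F (Real.log ‖x‖) with hG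
  have hG1 : ContDiff ℝ 1 G :=
    contDiff_mul_of_tsupport_subset hU hψ1 (hψt.trans hφU) (contDiffOn_comp_log_norm hF1)
  have hGc : HasCompactSupport G := hψc.mul_right
  have hGi : Integrable G μ := hG1.continuous.integrable_of_hasCompactSupport hGc
  have hPi : Integrable (fun x => ψ x * H (Real.log ‖x‖)) μ :=
    integrable_mul_of_tsupport_subset μ hU hψ1.continuous hψc (hψt.trans hφU)
      (contDiffOn_comp_log_norm hH1).continuousOn
  have hdGi : Integrable (fun x => fderiv ℝ G x x) μ := by
    refine Continuous.integrable_of_hasCompactSupport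
      ((hG1.continuous_fderiv one_ne_zero).clm_apply continuous_id) ?_
    exact (hGc.fderiv ℝ).mono fun x hx hx' => hx (by simp [hx'])
  have hPeq (x : E) : (|φ x| * (c - Real.log ‖x‖) ^ (σ - 1) * ‖x‖⁻¹) ^ n =
      ψ x * H (Real.log ‖x‖) := by
    by_cases hx : x ∈ tsupport φ
    · obtain ⟨hx0, hxc⟩ := hφU hx
      have ht : 0 < c - Real.log ‖x‖ := sub_pos.2 hxc
      have hxn : 0 < ‖x‖ := norm_pos_iff.2 hx0
      simp only [hψ, hH]
      rw [mul_pow, mul_pow, Real.rpow_natCast, ← Real.rpow_mul_natCast ht.le,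
        neg_mul, Real.exp_neg, mul_comm (n : ℝ) (Real.log _), ← Real.rpow_def_of_pos hxn,
        Real.rpow_natCast, inv_pow, Real.norm_eq_abs, mul_assoc]
      congr 4
      rw [hb]
      ring
    · have h0 : φ x = 0 := image_eq_zero_of_notMem_tsupport hx
      simp [hψ, h0, show n ≠ 0 by omega]
  have hQi : Integrable (fun x => (‖fderiv ℝ φ x‖ * (c - Real.log ‖x‖) ^ σ) ^ n) μ := by
    simp_rw [mul_pow]
    have hs : Function.support (fun x => ‖fderiv ℝ φ x‖ ^ n) ⊆ Function.support (fderiv ℝ φ) :=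
      fun x hx hx' => hx (by simp [hx', show n ≠ 0 by omega])
    refine integrable_mul_of_tsupport_subset μ hU (f := fun x => ‖fderiv ℝ φ x‖ ^ n)
      ((hφ.continuous_fderiv one_ne_zero).norm.pow n) ((hφc.fderiv ℝ).mono hs)
      ((closure_mono hs).trans ((tsupport_fderiv_subset ℝ).trans hφU)) ?_
    exact ((contDiffOn_comp_log_norm (contDiffOn_sub_rpow (n := 1) c σ)).continuousOn).pow n
  -- The left side equals `F (log ‖x‖)` times the derivative of `|φ|^n` in the direction `x`. Its
  -- first and third terms cancel on integration, by `integral_fderiv_apply_self`.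
  have hpt (x : E) : fderiv ℝ G x x + b * (ψ x * H (Real.log ‖x‖)) + n * G x ≤
      b / 2 * (ψ x * H (Real.log ‖x‖)) + n * (2 * n / b) ^ (n - 1) *
        (‖fderiv ℝ φ x‖ * (c - Real.log ‖x‖) ^ σ) ^ n := by
    by_cases hx : x ∈ tsupport φ
    · obtain ⟨hx0, hxc⟩ := hφU hx
      have ht : 0 < c - Real.log ‖x‖ := sub_pos.2 hxc
      have hxn : 0 < ‖x‖ := norm_pos_iff.2 hx0
      have hGd : fderiv ℝ G x x = fderiv ℝ ψ x x * F (Real.log ‖x‖) +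
          ψ x * (-b * H (Real.log ‖x‖) - n * F (Real.log ‖x‖)) := by
        have h1 := (hψ1.differentiable one_ne_zero x).hasFDerivAt
        have h2 := (hFd hxc).comp_hasFDerivAt x (hasFDerivAt_log_norm hx0)
        have h3 : HasFDerivAt G _ x := h1.mul h2
        rw [h3.fderiv]
        simp only [add_apply, smul_apply, smul_eq_mul,
          innerSL_apply_apply, real_inner_self_eq_norm_sq]
        have h5 : (‖x‖ ^ 2)⁻¹ * ‖x‖ ^ 2 = 1 := inv_mul_cancel₀ (by positivity)
        rw [h5]
        ring
      have h4 : fderiv ℝ G x x + b * (ψ x * H (Real.log ‖x‖)) + n * G x =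
          fderiv ℝ ψ x x * F (Real.log ‖x‖) := by
        rw [hGd]
        simp only [hG]
        ring
      rw [h4, ← hPeq]
      refine le_trans ?_ (mul_pow_mul_le (by omega) hb0 (by positivity) (by positivity))
      have hFpos : 0 ≤ F (Real.log ‖x‖) := by simp only [hF]; positivity
      have h5 : fderiv ℝ ψ x x ≤ n * ‖φ x‖ ^ ((n : ℝ) - 1) * ‖fderiv ℝ φ x‖ * ‖x‖ := by
        refine (le_abs_self _).trans (((fderiv ℝ ψ x).le_opNorm x).trans ?_)
        gcongr
        exact norm_fderiv_norm_rpow_le (hφ.differentiable one_ne_zero) hn1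
      refine (mul_le_mul_of_nonneg_right h5 hFpos).trans (le_of_eq ?_)
      obtain ⟨m, hm⟩ : ∃ m, n = m + 1 := ⟨n - 1, by omega⟩
      have hm' : (n : ℝ) - 1 = m := by rw [hm]; simp
      simp only [hF]
      rw [hm', neg_mul, Real.exp_neg, mul_comm (n : ℝ) (Real.log _), ← Real.rpow_def_of_pos hxn,
        Real.rpow_natCast, Real.rpow_natCast, Real.norm_eq_abs, show n - 1 = m by omega,
        mul_pow, mul_pow, ← Real.rpow_mul_natCast ht.le]
      -- Since `b = (σ - 1)(n - 1) + σ`, the weight splits exactly into the powers carried by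
      -- `P^(n-1)` and by `Q`.
      have h6 : (c - Real.log ‖x‖) ^ b =
          (c - Real.log ‖x‖) ^ ((σ - 1) * m) * (c - Real.log ‖x‖) ^ σ := by
        rw [← Real.rpow_add ht, hb, ← hm']
        congr 1
        ring
      rw [h6, hm, pow_succ, inv_pow]
      field_simp
    · have h0 : ψ x = 0 := image_eq_zero_of_notMem_tsupport fun h => hx (hψt h)
      have h1 : fderiv ℝ G x = 0 := by
        refine image_eq_zero_of_notMem_tsupport fun h => hx (hψt ?_)
        exact tsupport_mul_subset_left (tsupport_fderiv_subset ℝ h)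
      have h2 : fderiv ℝ φ x = 0 :=
        image_eq_zero_of_notMem_tsupport fun h => hx (tsupport_fderiv_subset ℝ h)
      have h3 : G x = 0 := by simp [hG, h0]
      rw [h0, h1, h2, h3]
      simp [show n ≠ 0 by omega]
  have hmono := integral_mono ((hdGi.add (hPi.const_mul b)).add (hGi.const_mul n))
    ((hPi.const_mul (b / 2)).add (hQi.const_mul _)) hpt
  have hi : Integrable (fun x => fderiv ℝ G x x + b * (ψ x * H (Real.log ‖x‖))) μ :=
    hdGi.add (hPi.const_mul b)
  simp only [Pi.add_apply] at hmono
  rw [integral_add hi (hGi.const_mul n),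
    integral_add hdGi (hPi.const_mul b), integral_add (hPi.const_mul (b / 2)) (hQi.const_mul _),
    integral_const_mul, integral_const_mul, integral_const_mul, integral_const_mul,
    integral_fderiv_apply_self μ hG1 hGc] at hmono
  simp_rw [hPeq]
  have h7 : b / 2 * ∫ x, ψ x * H (Real.log ‖x‖) ∂μ ≤ n * (2 * n / b) ^ (n - 1) *
      ∫ x, (‖fderiv ℝ φ x‖ * (c - Real.log ‖x‖) ^ σ) ^ n ∂μ := by linarith
  rw [mul_assoc, div_mul_eq_mul_div, le_div_iff₀ hb0]
  linarith

/-- Multiplication by a power of `c - log ‖x‖` turns the weighted norm of the gradient into the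
unweighted one. -/
theorem exists_lintegral_fderiv_mul_sub_log_rpow_le (μ : Measure E) [μ.IsAddHaarMeasure]
    (hE : 2 ≤ finrank ℝ E) {σ : ℝ} (hσ : 0 < finrank ℝ E * σ - finrank ℝ E + 1) :
    ∃ K : ℝ, 0 < K ∧ ∀ (c : ℝ) (φ : E → ℝ), ContDiff ℝ 1 φ → HasCompactSupport φ →
      tsupport φ ⊆ logDomain E c →
        ∫⁻ x, ‖fderiv ℝ (fun x => φ x * (c - Real.log ‖x‖) ^ σ) x‖ₑ ^ (finrank ℝ E : ℝ) ∂μ ≤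
          ENNReal.ofReal K *
            ∫⁻ x, ENNReal.ofReal ((‖fderiv ℝ φ x‖ * (c - Real.log ‖x‖) ^ σ) ^ finrank ℝ E) ∂μ := by
  set n := finrank ℝ E with hn
  have hn0 : n ≠ 0 := by omega
  set b : ℝ := n * σ - n + 1 with hb
  set K₁ : ℝ := 2 / b * (n * (2 * n / b) ^ (n - 1)) with hK₁
  have hK₁0 : 0 ≤ K₁ := by positivity
  -- The factor `2 ^ (n - 1)` comes from convexity of the `n`-th power applied to the two
  -- product-rule terms; `K₁` is the Hardy constant.
  refine ⟨2 ^ (n - 1) * (1 + |σ| ^ n * K₁), by positivity, fun c φ hφ hφc hφU => ?_⟩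
  have hU : IsOpen (logDomain E c) := isOpen_logDomain c
  set P : E → ℝ := fun x => |φ x| * (c - Real.log ‖x‖) ^ (σ - 1) * ‖x‖⁻¹ with hP
  set Q : E → ℝ := fun x => ‖fderiv ℝ φ x‖ * (c - Real.log ‖x‖) ^ σ with hQ
  have hv1 : ContDiff ℝ 1 (fun x => φ x * (c - Real.log ‖x‖) ^ σ) :=
    contDiff_mul_of_tsupport_subset hU hφ hφU
      (contDiffOn_comp_log_norm (contDiffOn_sub_rpow c σ))
  have hPc : Continuous P := by
    have h1 : ContDiffOn ℝ 0 (fun x : E => (c - Real.log ‖x‖) ^ (σ - 1) * ‖x‖⁻¹)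
        (logDomain E c) :=
      (contDiffOn_comp_log_norm (contDiffOn_sub_rpow c (σ - 1))).mul
        (contDiffOn_zero.2 (continuous_norm.continuousOn.inv₀ fun x hx => norm_ne_zero_iff.2 hx.1))
    have hs : Function.support (fun x => |φ x|) ⊆ Function.support φ :=
      fun x hx hx' => hx (by simp [hx'])
    have h2 : tsupport (fun x => |φ x|) ⊆ logDomain E c := (closure_mono hs).trans hφU
    have h3 := contDiff_mul_of_tsupport_subset hU (contDiff_zero.2 hφ.continuous.abs) h2 h1
    exact (contDiff_zero.1 h3).congr fun x => by simp only [hP, mul_assoc]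
  have hQc : Continuous Q := by
    have hs : Function.support (fun x => ‖fderiv ℝ φ x‖) ⊆ Function.support (fderiv ℝ φ) :=
      fun x hx hx' => hx (by simp only [hx', norm_zero])
    have h2 : tsupport (fun x => ‖fderiv ℝ φ x‖) ⊆ logDomain E c :=
      (closure_mono hs).trans ((tsupport_fderiv_subset ℝ).trans hφU)
    exact contDiff_zero.1 (contDiff_mul_of_tsupport_subset hU
      (contDiff_zero.2 (hφ.continuous_fderiv one_ne_zero).norm) h2
      (contDiffOn_comp_log_norm (contDiffOn_sub_rpow c σ)))
  have hP0 : ∀ x, 0 ≤ P x := fun x => by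
    by_cases hx : x ∈ tsupport φ
    · have ht : 0 < c - Real.log ‖x‖ := sub_pos.2 (hφU hx).2
      simp only [hP]
      positivity
    · simp [hP, image_eq_zero_of_notMem_tsupport hx]
  have hQ0 : ∀ x, 0 ≤ Q x := fun x => by
    by_cases hx : x ∈ tsupport φ
    · have ht : 0 < c - Real.log ‖x‖ := sub_pos.2 (hφU hx).2
      simp only [hQ]
      positivity
    · have h1 : fderiv ℝ φ x = 0 :=
        image_eq_zero_of_notMem_tsupport fun h => hx (tsupport_fderiv_subset ℝ h)
      simp only [hQ]
      rw [h1, norm_zero, zero_mul]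
  have hPi : Integrable (fun x => P x ^ n) μ :=
    Continuous.integrable_of_hasCompactSupport (hPc.pow n)
      (hφc.mono fun x hx hx' => hx (by simp [hP, hx', hn0]))
  have hQi : Integrable (fun x => Q x ^ n) μ :=
    Continuous.integrable_of_hasCompactSupport (hQc.pow n)
      ((hφc.fderiv ℝ).mono fun x hx hx' => hx (by
        simp only [hQ]
        rw [hx', norm_zero, zero_mul, zero_pow hn0]))
  have hpt (x : E) : ‖fderiv ℝ (fun x => φ x * (c - Real.log ‖x‖) ^ σ) x‖ ≤ Q x + |σ| * P x := by
    by_cases hx : x ∈ tsupport φ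
    · obtain ⟨hx0, hxc⟩ := hφU hx
      have ht : 0 < c - Real.log ‖x‖ := sub_pos.2 hxc
      have h1 := (hφ.differentiable one_ne_zero x).hasFDerivAt
      have h2 : HasDerivAt (fun y => (c - y) ^ σ) (-1 * σ * (c - Real.log ‖x‖) ^ (σ - 1))
          (Real.log ‖x‖) :=
        ((hasDerivAt_id _).const_sub c).rpow_const (Or.inl ht.ne')
      have h3 := h1.mul (h2.comp_hasFDerivAt x (hasFDerivAt_log_norm hx0))
      have h4 : fderiv ℝ (fun x => φ x * (c - Real.log ‖x‖) ^ σ) x = _ := h3.fderiv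
      rw [h4, add_comm (Q x)]
      refine (norm_add_le _ _).trans (le_of_eq ?_)
      rw [norm_smul, norm_smul, norm_fderiv_log_norm hx0, norm_smul]
      simp only [Function.comp_apply, norm_mul, norm_neg, norm_one, one_mul, Real.norm_eq_abs,
        Real.abs_rpow_of_nonneg ht.le, abs_of_pos ht, hP, hQ]
      ring
    · have h1 : fderiv ℝ (fun x => φ x * (c - Real.log ‖x‖) ^ σ) x = 0 :=
        image_eq_zero_of_notMem_tsupport fun h =>
          hx (tsupport_mul_subset_left (tsupport_fderiv_subset ℝ h))
      rw [h1, norm_zero]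
      have := hP0 x
      have := hQ0 x
      positivity
  have hpt' (x : E) : ‖fderiv ℝ (fun x => φ x * (c - Real.log ‖x‖) ^ σ) x‖ₑ ^ (n : ℝ) ≤
      ENNReal.ofReal (2 ^ (n - 1) * (Q x ^ n + |σ| ^ n * P x ^ n)) := by
    rw [← ofReal_norm, ENNReal.rpow_natCast, ← ENNReal.ofReal_pow (norm_nonneg _), ← mul_pow]
    refine ENNReal.ofReal_le_ofReal ((pow_le_pow_left₀ (norm_nonneg _) (hpt x) n).trans ?_)
    exact add_pow_le (hQ0 x) (mul_nonneg (abs_nonneg _) (hP0 x)) n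
  refine (lintegral_mono hpt').trans ?_
  have hi : Integrable (fun x => 2 ^ (n - 1) * (Q x ^ n + |σ| ^ n * P x ^ n)) μ :=
    (hQi.add (hPi.const_mul _)).const_mul _
  rw [← ofReal_integral_eq_lintegral_ofReal hi (Eventually.of_forall fun x => by
      have := hP0 x
      have := hQ0 x
      simp only [Pi.zero_apply]
      positivity),
    ← ofReal_integral_eq_lintegral_ofReal hQi (Eventually.of_forall fun x => pow_nonneg (hQ0 x) n),
    ← ENNReal.ofReal_mul (by positivity)]
  refine ENNReal.ofReal_le_ofReal ?_
  rw [integral_const_mul, integral_add hQi (hPi.const_mul _), integral_const_mul, mul_assoc]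
  have hH := integral_hardy_log_le μ hE hb hσ hφ hφc hφU
  calc 2 ^ (n - 1) * (∫ x, Q x ^ n ∂μ + |σ| ^ n * ∫ x, P x ^ n ∂μ)
      ≤ 2 ^ (n - 1) * (∫ x, Q x ^ n ∂μ + |σ| ^ n * (K₁ * ∫ x, Q x ^ n ∂μ)) := by
        gcongr
    _ = _ := by ring

end Hardy

/-! ### Part (i): the weighted exponential bound, its transfer to `Ω`, and the limit -/

section Bound

open Module

/-- The Trudinger inequality is applied to a multiple of `φ (c - log ‖x‖) ^ σ`. The constants are
chosen before `c`, hence will not depend on the domain. -/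
theorem exists_lintegral_exp_mul_rpow_mul_log_rpow_le {E : Type*} [NormedAddCommGroup E]
    [InnerProductSpace ℝ E] [FiniteDimensional ℝ E] [MeasurableSpace E] [BorelSpace E]
    (μ : Measure E) [μ.IsAddHaarMeasure] (hE : 2 ≤ finrank ℝ E) {p σ : ℝ}
    (hp : Real.HolderConjugate (finrank ℝ E) p)
    (hσ : 0 < finrank ℝ E * σ - finrank ℝ E + 1) (M : ℝ) (hM : 0 < M) :
    ∃ α : ℝ, 0 < α ∧ ∃ C : ℝ≥0∞, C ≠ ⊤ ∧ ∀ (c : ℝ) (φ : E → ℝ), ContDiff ℝ 1 φ →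
      HasCompactSupport φ → tsupport φ ⊆ logDomain E c →
      ∫⁻ x, ENNReal.ofReal ((‖fderiv ℝ φ x‖ * (c - Real.log ‖x‖) ^ σ) ^ finrank ℝ E) ∂μ ≤
        ENNReal.ofReal M → ∀ U : Set E, tsupport φ ⊆ U →
        ∫⁻ x in U, ENNReal.ofReal
          (Real.exp (α * |φ x| ^ p * (c - Real.log ‖x‖) ^ (σ * p))) ∂μ ≤ C * μ U := by
  obtain ⟨K, hK, hKle⟩ := exists_lintegral_fderiv_mul_sub_log_rpow_le μ hE hσ
  obtain ⟨α, hα, C, hC, H⟩ := exists_lintegral_exp_mul_abs_rpow_le μ hp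
  set n := finrank ℝ E with hn
  have hn0 : (n : ℝ) ≠ 0 := by
    have : n ≠ 0 := by omega
    exact_mod_cast this
  have hp0 : 0 < p := hp.symm.pos
  -- Normalizes the energy bound `K * M` of `w` to 1; the price is the factor `s ^ p` in the
  -- exponent.
  set s : ℝ := (K * M) ^ (-(n : ℝ)⁻¹) with hs
  have hs0 : 0 < s := by positivity
  have hsn : s ^ (n : ℝ) * (K * M) = 1 := by
    rw [hs, ← Real.rpow_mul (by positivity), neg_mul, inv_mul_cancel₀ hn0, Real.rpow_neg_one,
      inv_mul_cancel₀ (by positivity)]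
  refine ⟨α * s ^ p, by positivity, C, hC, fun c φ hφ hφc hφU hint U hU => ?_⟩
  set w : E → ℝ := fun x => φ x * (c - Real.log ‖x‖) ^ σ with hw
  have hw1 : ContDiff ℝ 1 w := contDiff_mul_of_tsupport_subset (isOpen_logDomain c) hφ hφU
    (contDiffOn_comp_log_norm (contDiffOn_sub_rpow c σ))
  have hgrad : ∫⁻ x, ‖fderiv ℝ (s • w) x‖ₑ ^ (n : ℝ) ∂μ ≤ 1 := by
    have h1 (x : E) : ‖fderiv ℝ (s • w) x‖ₑ ^ (n : ℝ) =
        ENNReal.ofReal (s ^ (n : ℝ)) * ‖fderiv ℝ w x‖ₑ ^ (n : ℝ) := by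
      rw [fderiv_const_smul (hw1.differentiable one_ne_zero x), enorm_smul,
        ENNReal.mul_rpow_of_nonneg _ _ (by positivity), Real.enorm_eq_ofReal hs0.le,
        ENNReal.ofReal_rpow_of_pos hs0]
    simp_rw [h1]
    rw [lintegral_const_mul' _ _ ENNReal.ofReal_ne_top]
    calc _ ≤ ENNReal.ofReal (s ^ (n : ℝ)) * (ENNReal.ofReal K * ENNReal.ofReal M) := by
          gcongr
          exact (hKle c φ hφ hφc hφU).trans (by gcongr)
      _ = 1 := by
          rw [← ENNReal.ofReal_mul hK.le, ← ENNReal.ofReal_mul (by positivity), hsn,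
            ENNReal.ofReal_one]
  have hsupp : tsupport (s • w) ⊆ tsupport φ :=
    (closure_mono (Function.support_const_smul_subset s w)).trans tsupport_mul_subset_left
  have key := H (s • w) (hw1.const_smul s) (hφc.mono' ((subset_tsupport _).trans hsupp)) hgrad U
    (hsupp.trans hU)
  refine le_trans (lintegral_mono fun x => le_of_eq ?_) key
  by_cases hx : x ∈ tsupport φ
  · have ht : 0 < c - Real.log ‖x‖ := sub_pos.2 (hφU hx).2
    simp only [Pi.smul_apply, smul_eq_mul, hw, abs_mul, abs_of_pos hs0,
      Real.abs_rpow_of_nonneg ht.le, abs_of_pos ht]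
    rw [Real.mul_rpow hs0.le (by positivity), Real.mul_rpow (abs_nonneg _) (by positivity),
      ← Real.rpow_mul ht.le]
    congr 2
    ring
  · have h0 : φ x = 0 := image_eq_zero_of_notMem_tsupport hx
    simp [hw, h0, Real.zero_rpow hp0.ne']

variable {N : ℕ}

theorem norm_le_outerRadius {Ω : Set (EuclideanSpace ℝ (Fin N))} (hb : Bornology.IsBounded Ω)
    {x : EuclideanSpace ℝ (Fin N)} (hx : x ∈ Ω) : ‖x‖ ≤ outerRadius Ω := by
  refine le_csSup ?_ (Set.mem_image_of_mem _ hx)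
  obtain ⟨C, hC⟩ := hb.exists_norm_le
  exact ⟨C, by rintro _ ⟨y, hy, rfl⟩; exact hC y hy⟩

theorem X1_div_outerRadius {Ω : Set (EuclideanSpace ℝ (Fin N))} (hb : Bornology.IsBounded Ω)
    {x : EuclideanSpace ℝ (Fin N)} (hx : x ∈ Ω) (hx0 : x ≠ 0) :
    X1 (‖x‖ / outerRadius Ω) = (1 + Real.log (outerRadius Ω) - Real.log ‖x‖)⁻¹ := by
  have hn : 0 < ‖x‖ := norm_pos_iff.2 hx0
  have hR : 0 < outerRadius Ω := hn.trans_le (norm_le_outerRadius hb hx)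
  rw [X1, Real.log_div (Real.exp_pos 1).ne' (by positivity), Real.log_exp,
    Real.log_div hn.ne' hR.ne']
  congr 1
  ring

theorem one_le_one_add_log_sub_log {Ω : Set (EuclideanSpace ℝ (Fin N))}
    (hb : Bornology.IsBounded Ω) {x : EuclideanSpace ℝ (Fin N)} (hx : x ∈ Ω) (hx0 : x ≠ 0) :
    1 ≤ 1 + Real.log (outerRadius Ω) - Real.log ‖x‖ := by
  have := Real.log_le_log (norm_pos_iff.2 hx0) (norm_le_outerRadius hb hx)
  linarith

theorem X1_rpow_neg {Ω : Set (EuclideanSpace ℝ (Fin N))} (hb : Bornology.IsBounded Ω)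
    {x : EuclideanSpace ℝ (Fin N)} (hx : x ∈ Ω) (hx0 : x ≠ 0) (r : ℝ) :
    X1 (‖x‖ / outerRadius Ω) ^ (-r) = (1 + Real.log (outerRadius Ω) - Real.log ‖x‖) ^ r := by
  have := one_le_one_add_log_sub_log hb hx hx0
  rw [X1_div_outerRadius hb hx hx0, Real.inv_rpow (by linarith), Real.rpow_neg (by linarith),
    inv_inv]

theorem measurable_X1 : Measurable X1 := by
  unfold X1
  fun_prop

theorem measurable_weight (β : ℝ) (Ω : Set (EuclideanSpace ℝ (Fin N))) :
    Measurable (weight β Ω) := by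
  unfold weight
  exact (measurable_X1.comp (by fun_prop)).pow_const _

theorem norm_gradient {F : Type*} [NormedAddCommGroup F] [InnerProductSpace ℝ F] [CompleteSpace F]
    (f : F → ℝ) (x : F) : ‖gradient f x‖ = ‖fderiv ℝ f x‖ :=
  LinearIsometryEquiv.norm_map _ _

theorem continuous_gradient {F : Type*} [NormedAddCommGroup F] [InnerProductSpace ℝ F]
    [CompleteSpace F] {f : F → ℝ} (hf : ContDiff ℝ 1 f) : Continuous (gradient f) :=
  (InnerProductSpace.toDual ℝ F).symm.continuous.comp (hf.continuous_fderiv one_ne_zero)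

theorem lintegral_weightedMeasure {U : Set (EuclideanSpace ℝ (Fin N))}
    {w : EuclideanSpace ℝ (Fin N) → ℝ} (hw : Measurable w)
    {f : EuclideanSpace ℝ (Fin N) → ℝ≥0∞} (hf : Measurable f) :
    ∫⁻ x, f x ∂(weightedMeasure U w) = ∫⁻ x in U, ENNReal.ofReal (w x) * f x := by
  rw [weightedMeasure, lintegral_withDensity_eq_lintegral_mul _ hw.ennreal_ofReal hf]
  rfl

theorem lintegral_fderiv_mul_log_rpow_le {Ω : Set (EuclideanSpace ℝ (Fin N))} (hN : 2 ≤ N)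
    (ho : IsOpen Ω) (hb : Bornology.IsBounded Ω) (β : ℝ) {φ : EuclideanSpace ℝ (Fin N) → ℝ}
    (hφ : IsCc 1 (Ω \ {0}) φ) :
    ∫⁻ x, ENNReal.ofReal ((‖fderiv ℝ φ x‖ *
        (1 + Real.log (outerRadius Ω) - Real.log ‖x‖) ^ (β * ((N : ℝ) - 1) / N)) ^ N) ≤
      eLpNorm (gradient φ) N (weightedMeasure (Ω \ {0}) (weight β Ω)) ^ N := by
  obtain ⟨h1, h2, h3⟩ := hφ
  have hN0 : N ≠ 0 := by omega
  have hN0' : (N : ℝ) ≠ 0 := by exact_mod_cast hN0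
  have hm : MeasurableSet (Ω \ {0}) := ho.measurableSet.diff (measurableSet_singleton 0)
  have hgm : Measurable (gradient φ) := (continuous_gradient h1).measurable
  have hR : eLpNorm (gradient φ) N (weightedMeasure (Ω \ {0}) (weight β Ω)) ^ N =
      ∫⁻ x in Ω \ {0}, ENNReal.ofReal (weight β Ω x) * ‖gradient φ x‖ₑ ^ N := by
    rw [eLpNorm_eq_lintegral_rpow_enorm_toReal (by exact_mod_cast hN0) (ENNReal.natCast_ne_top N),
      ENNReal.toReal_natCast, ← ENNReal.rpow_natCast, ← ENNReal.rpow_mul,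
      one_div_mul_cancel hN0', ENNReal.rpow_one]
    simp_rw [ENNReal.rpow_natCast]
    exact lintegral_weightedMeasure (measurable_weight β Ω) (by fun_prop)
  rw [hR, ← lintegral_indicator hm]
  refine lintegral_mono fun x => ?_
  by_cases hx : x ∈ Ω \ {0}
  · rw [Set.indicator_of_mem hx]
    have ht := one_le_one_add_log_sub_log hb hx.1 hx.2
    rw [weight, X1_rpow_neg hb hx.1 hx.2, ← ofReal_norm, norm_gradient,
      ← ENNReal.ofReal_pow (norm_nonneg _), ← ENNReal.ofReal_mul (by positivity), mul_pow,
      ← Real.rpow_mul_natCast (by positivity), div_mul_cancel₀ _ hN0', mul_comm]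
  · have h0 : fderiv ℝ φ x = 0 :=
      image_eq_zero_of_notMem_tsupport fun h => hx (h3 (tsupport_fderiv_subset ℝ h))
    rw [Set.indicator_of_notMem hx, h0, norm_zero, zero_mul, zero_pow hN0, ENNReal.ofReal_zero]

theorem restrict_diff_zero (hN : 2 ≤ N) (Ω : Set (EuclideanSpace ℝ (Fin N))) :
    (volume : Measure (EuclideanSpace ℝ (Fin N))).restrict (Ω \ {0}) = volume.restrict Ω := by
  have : NeZero N := ⟨by omega⟩
  exact Measure.restrict_congr_set (sdiff_null_ae_eq_self (measure_singleton _))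

theorem exists_expMean_le (hN : 2 ≤ N) {β : ℝ} (hβ : 1 < β) :
    ∃ α : ℝ, 0 < α ∧ ∃ C : ℝ≥0∞, C ≠ ⊤ ∧ ∀ Ω : Set (EuclideanSpace ℝ (Fin N)),
      IsOpen Ω → Bornology.IsBounded Ω → ∀ u ∈ unitBallW0 (Ω \ {0}) (weight β Ω),
        expMean β α Ω u ≤ C := by
  have hN1 : (1 : ℝ) < N := by exact_mod_cast hN
  have hN0 : (N : ℝ) ≠ 0 := by positivity
  have hfr : finrank ℝ (EuclideanSpace ℝ (Fin N)) = N := finrank_euclideanSpace_fin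
  set p : ℝ := (N : ℝ) / ((N : ℝ) - 1) with hp
  have hconj : Real.HolderConjugate N p := Real.HolderConjugate.conjExponent hN1
  have hp0 : 0 < p := hconj.symm.pos
  set σ : ℝ := β * ((N : ℝ) - 1) / N with hσ
  have hσp : σ * p = β := by
    have : (N : ℝ) - 1 ≠ 0 := by linarith
    rw [hσ, hp]
    field_simp
  -- The positivity condition reads `(β - 1)(N - 1) > 0`; this is where `β > 1` enters. The budget
  -- is `2 ^ N` because the approximants are only known to have norm at most 2 eventually.
  obtain ⟨α, hα, C, hC, H⟩ := exists_lintegral_exp_mul_rpow_mul_log_rpow_le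
    (volume : Measure (EuclideanSpace ℝ (Fin N))) (by rw [hfr]; exact hN) (p := p) (σ := σ)
    (by rw [hfr]; exact hconj) (by
      rw [hfr, hσ, mul_div_cancel₀ _ hN0]
      nlinarith) (2 ^ N) (by positivity)
  rw [hfr, hσp] at H
  refine ⟨α, hα, C, hC, fun Ω ho hb u ⟨g, hg, hg1⟩ => ?_⟩
  obtain ⟨φ, hφ, hlim, hglim⟩ := hg.approx
  set c : ℝ := 1 + Real.log (outerRadius Ω)
  have hN0' : ((N : ℕ) : ℝ≥0∞) ≠ 0 := by
    have : N ≠ 0 := by omega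
    exact_mod_cast this
  have hae : ∀ᵐ x ∂(volume.restrict Ω : Measure (EuclideanSpace ℝ (Fin N))), x ∈ Ω \ {0} := by
    rw [← restrict_diff_zero hN]
    exact ae_restrict_mem (ho.measurableSet.diff (measurableSet_singleton 0))
  have hbound : ∀ᶠ k in atTop, ∫⁻ x in Ω, ENNReal.ofReal (Real.exp
      (α * |φ k x| ^ p * X1 (‖x‖ / outerRadius Ω) ^ (-β))) ≤ C * volume Ω := by
    filter_upwards [hglim.eventually (ge_mem_nhds one_pos)] with k hk
    have hle2 : eLpNorm (gradient (φ k)) N (weightedMeasure (Ω \ {0}) (weight β Ω)) ≤ 2 := by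
      have h1 := eLpNorm_add_le (μ := weightedMeasure (Ω \ {0}) (weight β Ω))
        (f := fun x => gradient (φ k) x - g x) (g := g) (p := (N : ℝ≥0∞))
        ((continuous_gradient (hφ k).1).aestronglyMeasurable.sub hg.memLp_grad.1)
        hg.memLp_grad.1 (by exact_mod_cast hN1.le)
      have h2 : (fun x => gradient (φ k) x - g x) + g = gradient (φ k) := by
        ext1 x
        simp
      rw [h2] at h1
      exact h1.trans ((add_le_add hk hg1).trans (by norm_num))
    have hsub : tsupport (φ k) ⊆ logDomain (EuclideanSpace ℝ (Fin N)) c := fun x hx => by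
      have hx' := (hφ k).2.2 hx
      have := one_le_one_add_log_sub_log hb hx'.1 hx'.2
      exact ⟨hx'.2, by linarith⟩
    have h3 := H c (φ k) (hφ k).1 (hφ k).2.1 hsub
      ((lintegral_fderiv_mul_log_rpow_le hN ho hb β (hφ k)).trans (by
        rw [ENNReal.ofReal_pow zero_le_two, ENNReal.ofReal_ofNat]
        gcongr)) Ω ((hφ k).2.2.trans Set.sdiff_subset)
    refine le_trans (le_of_eq (lintegral_congr_ae ?_)) h3
    filter_upwards [hae] with x hx
    rw [X1_rpow_neg hb hx.1 hx.2]
  have hmeas : TendstoInMeasure (volume.restrict (Ω \ {0})) φ atTop u :=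
    tendstoInMeasure_of_tendsto_eLpNorm hN0'
      (fun k => (hφ k).1.continuous.aestronglyMeasurable) hg.memLp.1 hlim
  obtain ⟨ns, hns, hnsae⟩ := hmeas.exists_seq_tendsto_ae
  rw [restrict_diff_zero hN] at hnsae
  set f : (EuclideanSpace ℝ (Fin N) → ℝ) → EuclideanSpace ℝ (Fin N) → ℝ≥0∞ := fun v x =>
    ENNReal.ofReal (Real.exp (α * |v x| ^ p * X1 (‖x‖ / outerRadius Ω) ^ (-β))) with hf
  have hfm (k : ℕ) : Measurable (f (φ (ns k))) := by
    have h1 := (hφ (ns k)).1.continuous.measurable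
    have h2 : Measurable fun x : EuclideanSpace ℝ (Fin N) => X1 (‖x‖ / outerRadius Ω) ^ (-β) :=
      (measurable_X1.comp (by fun_prop)).pow_const _
    exact ((((h1.abs.pow_const p).const_mul α).mul h2).exp).ennreal_ofReal
  -- Along a subsequence the approximants converge almost everywhere, so Fatou's lemma carries the
  -- uniform bound over to `u`.
  have hfatou : ∫⁻ x in Ω, f u x ≤ C * volume Ω := by
    calc ∫⁻ x in Ω, f u x = ∫⁻ x in Ω, liminf (fun k => f (φ (ns k)) x) atTop := by
          refine lintegral_congr_ae ?_
          filter_upwards [hnsae] with x hx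
          refine (Tendsto.liminf_eq ?_).symm
          refine ENNReal.tendsto_ofReal ((Real.continuous_exp.tendsto _).comp ?_)
          exact ((hx.abs.rpow_const (Or.inr hp0.le)).const_mul α).mul_const _
      _ ≤ liminf (fun k => ∫⁻ x in Ω, f (φ (ns k)) x) atTop := lintegral_liminf_le hfm
      _ ≤ liminf (fun _ : ℕ => C * volume Ω) atTop :=
          liminf_le_liminf (hns.tendsto_atTop.eventually hbound)
      _ = _ := liminf_const _
  rw [expMean, setLAverage_eq]
  exact ENNReal.div_le_of_le_mul hfatou

end Bound

/-! ### Part (ii): divergence for functions constant near the origin -/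

section Unbounded

variable {N : ℕ}

theorem isWeakGradient_gradient {U : Set (EuclideanSpace ℝ (Fin N))}
    {φ : EuclideanSpace ℝ (Fin N) → ℝ} (hφ : IsCc 1 U φ) :
    IsWeakGradient U φ (gradient φ) := by
  obtain ⟨h1, h2, h3⟩ := hφ
  refine ⟨h1.continuous.locallyIntegrable.locallyIntegrableOn _,
    (continuous_gradient h1).locallyIntegrable.locallyIntegrableOn _, fun ψ ⟨k1, k2, k3⟩ => ?_⟩
  have k1' : ContDiff ℝ 1 ψ := k1.of_le (by exact_mod_cast le_top)
  rw [setIntegral_eq_integral_of_forall_compl_eq_zero fun x hx => by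
      rw [image_eq_zero_of_notMem_tsupport fun h => hx (h3 h), zero_smul],
    setIntegral_eq_integral_of_forall_compl_eq_zero fun x hx => by
      rw [image_eq_zero_of_notMem_tsupport fun h => hx (k3 h), zero_smul]]
  have hi1 : Integrable (fun x => φ x • gradient ψ x) :=
    (h1.continuous.smul (continuous_gradient k1')).integrable_of_hasCompactSupport
      (h2.mono fun x hx hx' => hx (by
        change φ x • gradient ψ x = 0
        rw [show φ x = 0 from hx', zero_smul]))
  have hi2 : Integrable (fun x => ψ x • gradient φ x) :=
    (k1.continuous.smul (continuous_gradient h1)).integrable_of_hasCompactSupport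
      (k2.mono fun x hx hx' => hx (by
        change ψ x • gradient φ x = 0
        rw [show ψ x = 0 from hx', zero_smul]))
  refine ext_inner_left ℝ fun v => ?_
  have hinner (f : EuclideanSpace ℝ (Fin N) → ℝ) (x : EuclideanSpace ℝ (Fin N)) :
      inner ℝ v (gradient f x) = fderiv ℝ f x v := by
    rw [real_inner_comm]
    exact InnerProductSpace.toDual_symm_apply
  rw [inner_neg_right, ← integral_inner hi1, ← integral_inner hi2]
  simp_rw [inner_smul_right, hinner]
  rw [integral_mul_fderiv_eq_neg_fderiv_mul_of_integrable]
  · simp_rw [mul_comm]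
  · exact (((h1.continuous_fderiv one_ne_zero).clm_apply continuous_const).mul
      k1.continuous).integrable_of_hasCompactSupport k2.mul_left
  · exact (h1.continuous.mul ((k1'.continuous_fderiv one_ne_zero).clm_apply
      continuous_const)).integrable_of_hasCompactSupport h2.mul_right
  · exact (h1.continuous.mul k1.continuous).integrable_of_hasCompactSupport h2.mul_right
  · exact fun x _ => h1.differentiable one_ne_zero x
  · exact fun x _ => k1'.differentiable one_ne_zero x

theorem memW0_of_isCc {U : Set (EuclideanSpace ℝ (Fin N))}
    {w : EuclideanSpace ℝ (Fin N) → ℝ} {φ : EuclideanSpace ℝ (Fin N) → ℝ} (hφ : IsCc 1 U φ)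
    (h : eLpNorm (gradient φ) N (weightedMeasure U w) < ⊤) : MemW0 U w φ (gradient φ) where
  memLp := (hφ.1.continuous.memLp_of_hasCompactSupport hφ.2.1).restrict _
  memLp_grad := ⟨(continuous_gradient hφ.1).aestronglyMeasurable, h⟩
  weakGradient := isWeakGradient_gradient hφ
  approx := ⟨fun _ => φ, fun _ => hφ, by simp, by simp⟩

/-- The weight is unbounded only near the origin, where the gradient vanishes. -/
theorem eLpNorm_gradient_lt_top_of_eqOn_ball {Ω : Set (EuclideanSpace ℝ (Fin N))} (hN : 2 ≤ N)
    (ho : IsOpen Ω) (hb : Bornology.IsBounded Ω) {β : ℝ} (hβ : 0 ≤ β)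
    {φ : EuclideanSpace ℝ (Fin N) → ℝ} (hφ : IsCc 1 Ω φ) {r : ℝ} (hr : 0 < r)
    (hφr : ∀ x ∈ Metric.ball (0 : EuclideanSpace ℝ (Fin N)) r, φ x = 1) :
    eLpNorm (gradient φ) N (weightedMeasure Ω (weight β Ω)) < ⊤ := by
  obtain ⟨h1, h2, h3⟩ := hφ
  have hN0 : N ≠ 0 := by omega
  have hN1 : (1 : ℝ) ≤ N := by exact_mod_cast (by omega : 1 ≤ N)
  have hgc := continuous_gradient h1
  obtain ⟨B, hB⟩ := hgc.bounded_above_of_compact_support (h2.fderiv ℝ |>.mono' (by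
    refine (fun x hx => subset_tsupport _ fun h => hx ?_)
    rw [← norm_eq_zero, norm_gradient, h, norm_zero]))
  set W : ℝ := (1 + Real.log (outerRadius Ω) - Real.log r) ^ (β * ((N : ℝ) - 1))
  rw [eLpNorm_lt_top_iff_lintegral_rpow_enorm_lt_top (by exact_mod_cast hN0)
    (ENNReal.natCast_ne_top N), ENNReal.toReal_natCast]
  simp_rw [ENNReal.rpow_natCast]
  rw [lintegral_weightedMeasure (measurable_weight β Ω) (by have := hgc.measurable; fun_prop)]
  refine lt_of_le_of_lt (setLIntegral_mono' (g := fun _ => ENNReal.ofReal W * ENNReal.ofReal B ^ N)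
    ho.measurableSet fun x hx => ?_) ?_
  · by_cases hxr : x ∈ Metric.ball (0 : EuclideanSpace ℝ (Fin N)) r
    · have h0 : fderiv ℝ φ x = 0 := by
        have : φ =ᶠ[𝓝 x] fun _ => 1 := by
          filter_upwards [Metric.isOpen_ball.mem_nhds hxr] with y hy using hφr y hy
        rw [this.fderiv_eq]
        simp
      rw [← ofReal_norm, norm_gradient, h0, norm_zero, ENNReal.ofReal_zero, zero_pow hN0, mul_zero]
      exact zero_le
    · have hxr' : r ≤ ‖x‖ := by simpa using hxr
      have hx0 : x ≠ 0 := norm_pos_iff.1 (hr.trans_le hxr')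
      rw [weight, X1_rpow_neg hb hx hx0, ← ofReal_norm]
      have ht := one_le_one_add_log_sub_log hb hx hx0
      have hlog := Real.log_le_log hr hxr'
      refine mul_le_mul' (ENNReal.ofReal_le_ofReal (Real.rpow_le_rpow (by linarith) (by linarith)
        (mul_nonneg hβ (by linarith)))) ?_
      gcongr
      exact hB x
  · rw [setLIntegral_const]
    exact ENNReal.mul_lt_top (ENNReal.mul_lt_top ENNReal.ofReal_lt_top
      (ENNReal.pow_lt_top ENNReal.ofReal_lt_top)) hb.measure_lt_top

/-- With `t = c - log y → ∞`, a superlinear power of `t` dominates a linear function of it.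
Exponentiated: `exp (a t^β) ≥ y^(-m)` for small `y`. -/
theorem eventually_log_le_mul_sub_log_rpow {β : ℝ} (hβ : 1 < β) {a : ℝ} (ha : 0 < a) (c m : ℝ)
    (hm : 0 ≤ m) : ∀ᶠ y in 𝓝[>] (0 : ℝ), -(m * Real.log y) ≤ a * (c - Real.log y) ^ β := by
  have ht : Tendsto (fun y => c - Real.log y) (𝓝[>] 0) atTop := by
    simp_rw [sub_eq_add_neg]
    exact tendsto_atTop_add_const_left _ _ (tendsto_neg_atBot_atTop.comp
      Real.tendsto_log_nhdsGT_zero)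
  have h1 := (tendsto_rpow_atTop (sub_pos.2 hβ)).comp ht
  filter_upwards [h1.eventually_ge_atTop (m * (1 + |c|) / a), ht.eventually_ge_atTop 1] with y hy h2
  simp only [Function.comp_apply] at hy
  set t := c - Real.log y with htd
  have h3 : t ^ β = t ^ (β - 1) * t := by
    rw [Real.rpow_sub_one (by positivity)]
    field_simp
  rw [div_le_iff₀ ha] at hy
  have h4 : m * (1 + |c|) * t ≤ t ^ (β - 1) * a * t := by gcongr
  have h5 : t - c ≤ (1 + |c|) * t := by
    nlinarith [neg_abs_le c, abs_nonneg c]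
  calc -(m * Real.log y) = m * (t - c) := by rw [htd]; ring
    _ ≤ m * ((1 + |c|) * t) := by gcongr
    _ ≤ t ^ (β - 1) * a * t := by rw [← mul_assoc]; exact h4
    _ = a * t ^ β := by rw [h3]; ring

theorem expMean_eq_top {Ω : Set (EuclideanSpace ℝ (Fin N))} (hN : 2 ≤ N) (ho : IsOpen Ω)
    (hb : Bornology.IsBounded Ω) (h0 : (0 : EuclideanSpace ℝ (Fin N)) ∈ Ω) {β α s r : ℝ}
    (hβ : 1 < β) (hα : 0 < α) (hs : s ≠ 0) (hr : 0 < r) {u : EuclideanSpace ℝ (Fin N) → ℝ}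
    (hu : ∀ x ∈ Metric.ball (0 : EuclideanSpace ℝ (Fin N)) r, u x = s) :
    expMean β α Ω u = ⊤ := by
  have : NeZero N := ⟨by omega⟩
  set a : ℝ := α * |s| ^ ((N : ℝ) / ((N : ℝ) - 1)) with ha
  have ha0 : 0 < a := by positivity
  set c : ℝ := 1 + Real.log (outerRadius Ω) with hc
  obtain ⟨δ, hδ, hball⟩ := Metric.isOpen_iff.1 ho 0 h0
  -- The power `2 * N` exceeds the dimension by `N`, so the integral over the ball of radius `η` is
  -- at least a multiple of `η^(-N)`, which is unbounded as `η → 0`.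
  obtain ⟨ρ, hρ, hlog⟩ := mem_nhdsGT_iff_exists_Ioo_subset.1
    (eventually_log_le_mul_sub_log_rpow hβ ha0 c (2 * N) (by positivity))
  set ε : ℝ := min ρ (min r δ) with hε
  have hε0 : 0 < ε := lt_min hρ (lt_min hr hδ)
  set I := ∫⁻ x in Ω, ENNReal.ofReal (Real.exp (α * |u x| ^ ((N : ℝ) / ((N : ℝ) - 1)) *
    X1 (‖x‖ / outerRadius Ω) ^ (-β))) with hI
  set V := volume (Metric.ball (0 : EuclideanSpace ℝ (Fin N)) 1)
  have hV : V ≠ 0 := (Metric.measure_ball_pos _ _ one_pos).ne'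
  have hlow : ∀ η : ℝ, 0 < η → η < ε → ENNReal.ofReal (η⁻¹ ^ N) * V ≤ I := by
    intro η hη hηε
    have hsub : Metric.ball (0 : EuclideanSpace ℝ (Fin N)) η \ {0} ⊆ Ω := fun x hx =>
      hball (Metric.ball_subset_ball (hηε.le.trans ((min_le_right _ _).trans (min_le_right _ _)))
        hx.1)
    calc ENNReal.ofReal (η⁻¹ ^ N) * V
        = ENNReal.ofReal (η⁻¹ ^ (2 * N)) * volume (Metric.ball (0 : EuclideanSpace ℝ (Fin N)) η) := by
          rw [Measure.addHaar_ball _ _ hη.le, finrank_euclideanSpace_fin, ← mul_assoc,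
            ← ENNReal.ofReal_mul (by positivity)]
          congr 2
          rw [two_mul, pow_add, mul_assoc, ← mul_pow, inv_mul_cancel₀ hη.ne', one_pow, mul_one]
      _ = ∫⁻ x in Metric.ball (0 : EuclideanSpace ℝ (Fin N)) η \ {0},
            ENNReal.ofReal (η⁻¹ ^ (2 * N)) := by
          rw [restrict_diff_zero hN, setLIntegral_const]
      _ ≤ ∫⁻ x in Metric.ball (0 : EuclideanSpace ℝ (Fin N)) η \ {0}, ENNReal.ofReal (Real.exp
            (α * |u x| ^ ((N : ℝ) / ((N : ℝ) - 1)) * X1 (‖x‖ / outerRadius Ω) ^ (-β))) := by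
          refine setLIntegral_mono' (Metric.isOpen_ball.measurableSet.diff
            (measurableSet_singleton 0)) fun x hx => ENNReal.ofReal_le_ofReal ?_
          have hxn : 0 < ‖x‖ := norm_pos_iff.2 hx.2
          have hxη : ‖x‖ < η := by simpa using hx.1
          have hxr : x ∈ Metric.ball (0 : EuclideanSpace ℝ (Fin N)) r := by
            rw [mem_ball_zero_iff]
            exact (hxη.trans hηε).trans_le ((min_le_right _ _).trans (min_le_left _ _))
          rw [hu x hxr, X1_rpow_neg hb (hsub hx) hx.2]
          have h1 : -(2 * N * Real.log ‖x‖) ≤ a * (c - Real.log ‖x‖) ^ β :=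
            hlog ⟨hxn, (hxη.trans hηε).trans_le (min_le_left _ _)⟩
          calc η⁻¹ ^ (2 * N) ≤ ‖x‖⁻¹ ^ (2 * N) := by gcongr
            _ = Real.exp (-(2 * N * Real.log ‖x‖)) := by
              rw [Real.exp_neg, inv_pow, ← Real.rpow_natCast, Real.rpow_def_of_pos hxn,
                mul_comm (2 * (N : ℝ))]
              push_cast
              rfl
            _ ≤ _ := Real.exp_le_exp.2 h1
      _ ≤ I := lintegral_mono_set hsub
  have hItop : I = ⊤ := by
    have h1 : Tendsto (fun η : ℝ => ENNReal.ofReal (η⁻¹ ^ N) * V) (𝓝[>] 0) (𝓝 (⊤ * V)) := by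
      refine ENNReal.Tendsto.mul_const (ENNReal.tendsto_ofReal_atTop.comp ?_)
        (Or.inl ENNReal.top_ne_zero)
      exact (tendsto_pow_atTop (by omega)).comp tendsto_inv_nhdsGT_zero
    rw [ENNReal.top_mul hV] at h1
    refine top_unique (le_of_tendsto h1 ?_)
    filter_upwards [Ioo_mem_nhdsGT hε0] with η hη using hlow η hη.1 hη.2
  rw [expMean, setLAverage_eq, ← hI, hItop]
  exact ENNReal.top_div_of_ne_top hb.measure_lt_top.ne

theorem iSup_expMean_eq_top {Ω : Set (EuclideanSpace ℝ (Fin N))} (hN : 2 ≤ N) (ho : IsOpen Ω)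
    (hb : Bornology.IsBounded Ω) (h0 : (0 : EuclideanSpace ℝ (Fin N)) ∈ Ω) {β α : ℝ}
    (hβ : 1 < β) (hα : 0 < α) :
    ⨆ u ∈ unitBallW0 Ω (weight β Ω), expMean β α Ω u = ⊤ := by
  obtain ⟨δ, hδ, hball⟩ := Metric.isOpen_iff.1 ho 0 h0
  let f : ContDiffBump (0 : EuclideanSpace ℝ (Fin N)) :=
    ⟨δ / 3, δ / 2, by positivity, by linarith⟩
  have hf : IsCc 1 Ω f := by
    refine ⟨f.contDiff, f.hasCompactSupport, ?_⟩
    rw [f.tsupport_eq]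
    exact (Metric.closedBall_subset_ball (half_lt_self hδ)).trans hball
  have hf1 : ∀ x ∈ Metric.ball (0 : EuclideanSpace ℝ (Fin N)) (δ / 3), f x = 1 := fun x hx =>
    f.one_of_mem_closedBall (Metric.ball_subset_closedBall hx)
  have hA := eLpNorm_gradient_lt_top_of_eqOn_ball (β := β) hN ho hb (by linarith) hf (by positivity) hf1
  set A := eLpNorm (gradient f) N (weightedMeasure Ω (weight β Ω)) with hAd
  -- Rescales the bump into the unit ball; the `+ 1` avoids having to show `A ≠ 0`.
  set s : ℝ := (A.toReal + 1)⁻¹ with hs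
  have hs0 : 0 < s := by positivity
  have hsf : IsCc 1 Ω (s • (f : EuclideanSpace ℝ (Fin N) → ℝ)) := by
    have hsub := closure_mono (Function.support_const_smul_subset s
      (f : EuclideanSpace ℝ (Fin N) → ℝ))
    exact ⟨hf.1.const_smul s, hf.2.1.mono' ((subset_tsupport _).trans hsub), hsub.trans hf.2.2⟩
  have hgrad : gradient (s • (f : EuclideanSpace ℝ (Fin N) → ℝ)) = s • gradient f := by
    ext1 x
    rw [gradient, fderiv_const_smul (hf.1.differentiable one_ne_zero x), map_smulₛₗ]
    rfl
  have hle : eLpNorm (gradient (s • (f : EuclideanSpace ℝ (Fin N) → ℝ))) N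
      (weightedMeasure Ω (weight β Ω)) ≤ 1 := by
    rw [hgrad, eLpNorm_const_smul, ← hAd, ← ENNReal.ofReal_toReal hA.ne,
      Real.enorm_eq_ofReal hs0.le, ← ENNReal.ofReal_mul hs0.le, ENNReal.ofReal_le_one, hs,
      inv_mul_le_one₀ (by positivity)]
    linarith
  refine top_unique (le_iSup₂_of_le (s • (f : EuclideanSpace ℝ (Fin N) → ℝ))
    ⟨_, memW0_of_isCc hsf (hle.trans_lt ENNReal.one_lt_top), hle⟩ (le_of_eq ?_))
  refine (expMean_eq_top hN ho hb h0 hβ hα hs0.ne' (r := δ / 3) (by positivity) fun x hx => ?_).symm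
  rw [Pi.smul_apply, hf1 x hx, smul_eq_mul, mul_one]

end Unbounded

end LogWeight

theorem theorem1p8 (N : ℕ) (hN : 2 ≤ N) (β : ℝ) (hβ : 1 < β) :
    (∃ α : ℝ, 0 < α ∧
      ∀ Ω : Set (EuclideanSpace ℝ (Fin N)),
        IsOpen Ω → IsConnected Ω → Bornology.IsBounded Ω →
          (⨆ u ∈ LogWeight.unitBallW0 (Ω \ {0}) (LogWeight.weight β Ω),
            LogWeight.expMean β α Ω u) < ⊤) ∧
    (∀ Ω : Set (EuclideanSpace ℝ (Fin N)),
      IsOpen Ω → IsConnected Ω → Bornology.IsBounded Ω → (0 : EuclideanSpace ℝ (Fin N)) ∈ Ω →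
        ∀ α : ℝ, 0 < α →
          (⨆ u ∈ LogWeight.unitBallW0 Ω (LogWeight.weight β Ω),
            LogWeight.expMean β α Ω u) = ⊤) := by
  refine ⟨?_, fun Ω ho _ hb h0 α hα => LogWeight.iSup_expMean_eq_top hN ho hb h0 hβ hα⟩
  obtain ⟨α, hα, C, hC, h⟩ := LogWeight.exists_expMean_le hN hβ
  exact ⟨α, hα, fun Ω ho _ hb => (iSup₂_le (h Ω ho hb)).trans_lt hC.lt_top⟩
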